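/- Let $E$ be the elliptic curve $y^2 = x^3 - (t^2+27)x + 10t^2+48t+90$ over $\mathbb{Q}(t)$, and let $M \subset E(\mathbb{Q}(t))$ be the subgroup generated by the two points $P = (t+3,\,4t+6)$ and $Q = (9,\,t+24)$. For $t_0 \in \mathbb{Q}$ let $E_{t_0}$ be the curve $y^2 = x^3 - (t_0^2+27)x + 10t_0^2+48t_0+90$ over $\mathbb{Q}$; when $E_{t_0}$ is an elliptic curve, let $\sigma_{t_0} : E(\mathbb{Q}(t)) \to E_{t_0}(\mathbb{Q})$ be the specialization map, which sends $(x(t),y(t))$ to $(x(t_0),y(t_0))$ if the coordinates have no pole at $t_0$, and sends all other points, including the point at infinity, to the point at infinity. Let $t_0 \in \mathbb{Q}$ be a rational number such that $$t_0 \notin \{-26,-19,-12,-11,-5,-3,-1,6,9,44\}$$ and such that the polynomial $g(t_0,x) = x^3 - (t_0^2+27)x + 10t_0^2+48t_0+90 \in \mathbb{Q}[x]$ has no rational root. Then $E_{t_0}$ is an elliptic curve and the restriction $\sigma_{t_0}|_M : M \to E_{t_0}(\mathbb{Q})$ is injective. -/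

import Mathlib

open Polynomial

noncomputable section

namespace EllipticSpecialization

/-- The Weierstrass curve `y² = x³ + A(t) x + B(t)` over the rational function field `ℚ(t)`,
where `A` and `B` are polynomials in `t`. -/
def generic (A B : ℚ[X]) : WeierstrassCurve.Affine (RatFunc ℚ) where
  a₁ := 0
  a₂ := 0
  a₃ := 0
  a₄ := algebraMap ℚ[X] (RatFunc ℚ) A
  a₆ := algebraMap ℚ[X] (RatFunc ℚ) B

/-- The specialized Weierstrass curve `y² = x³ + A(t₀) x + B(t₀)` over `ℚ`. -/
def fiber (A B : ℚ[X]) (t₀ : ℚ) : WeierstrassCurve.Affine ℚ where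
  a₁ := 0
  a₂ := 0
  a₃ := 0
  a₄ := A.eval t₀
  a₆ := B.eval t₀

/-- The value at `t₀` of a rational function that has no pole at `t₀`. -/
def value (t₀ : ℚ) (f : RatFunc ℚ) : ℚ := f.eval (RingHom.id ℚ) t₀

/-- If the `x`-coordinate of a point has no pole at `t₀`, then neither does the `y`-coordinate. -/
theorem denom_y_ne_zero {A B : ℚ[X]} {t₀ : ℚ} {x y : RatFunc ℚ}
    (h : (generic A B).Equation x y) (hx : x.denom.eval t₀ ≠ 0) : y.denom.eval t₀ ≠ 0 := by
  intro hy
  have hxd : algebraMap ℚ[X] (RatFunc ℚ) x.denom ≠ 0 := by simpa using x.denom_ne_zero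
  have hyd : algebraMap ℚ[X] (RatFunc ℚ) y.denom ≠ 0 := by simpa using y.denom_ne_zero
  have h1 : y ^ 2 = x ^ 3 + algebraMap ℚ[X] (RatFunc ℚ) A * x + algebraMap ℚ[X] (RatFunc ℚ) B := by
    have := (WeierstrassCurve.Affine.equation_iff x y).1 h
    simpa [generic] using this
  rw [← x.num_div_denom, ← y.num_div_denom] at h1
  field_simp at h1
  have h2 : y.num ^ 2 * x.denom ^ 3 =
      y.denom ^ 2 * (x.num ^ 3 + x.denom ^ 2 * A * x.num + x.denom ^ 3 * B) := by
    apply RatFunc.algebraMap_injective ℚ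
    simp only [map_mul, map_pow, map_add]
    linear_combination h1
  have h3 := congrArg (Polynomial.eval t₀) h2
  simp only [eval_mul, eval_pow, hy] at h3
  have h4 : y.num.eval t₀ = 0 := by
    by_contra h5
    have : y.num.eval t₀ ^ 2 * x.denom.eval t₀ ^ 3 ≠ 0 := by positivity
    apply this
    rw [h3]
    ring
  obtain ⟨a, b, hab⟩ := y.isCoprime_num_denom
  have := congrArg (Polynomial.eval t₀) hab
  simp [hy, h4] at this

/-- If the `x`-coordinate of a point has no pole at `t₀`, then the values of the coordinates
at `t₀` satisfy the specialized equation. -/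
theorem equation_value {A B : ℚ[X]} {t₀ : ℚ} {x y : RatFunc ℚ}
    (h : (generic A B).Equation x y) (hx : x.denom.eval t₀ ≠ 0) :
    (fiber A B t₀).Equation (value t₀ x) (value t₀ y) := by
  have hy := denom_y_ne_zero h hx
  have hxd : algebraMap ℚ[X] (RatFunc ℚ) x.denom ≠ 0 := by simpa using x.denom_ne_zero
  have hyd : algebraMap ℚ[X] (RatFunc ℚ) y.denom ≠ 0 := by simpa using y.denom_ne_zero
  have h1 : y ^ 2 = x ^ 3 + algebraMap ℚ[X] (RatFunc ℚ) A * x + algebraMap ℚ[X] (RatFunc ℚ) B := by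
    have := (WeierstrassCurve.Affine.equation_iff x y).1 h
    simpa [generic] using this
  rw [← x.num_div_denom, ← y.num_div_denom] at h1
  field_simp at h1
  have h2 : y.num ^ 2 * x.denom ^ 3 =
      y.denom ^ 2 * (x.num ^ 3 + x.denom ^ 2 * A * x.num + x.denom ^ 3 * B) := by
    apply RatFunc.algebraMap_injective ℚ
    simp only [map_mul, map_pow, map_add]
    linear_combination h1
  have h3 := congrArg (Polynomial.eval t₀) h2
  simp only [eval_mul, eval_pow, eval_add] at h3
  rw [WeierstrassCurve.Affine.equation_iff]
  simp only [fiber, value, RatFunc.eval, Polynomial.eval₂_id]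
  field_simp
  linear_combination h3

/-- The specialization map `σ_{t₀} : E(ℚ(t)) → E_{t₀}(ℚ)`, defined when the specialized curve
`E_{t₀}` is an elliptic curve. It sends `(x(t), y(t))` to `(x(t₀), y(t₀))`; a point whose
coordinates have a pole at `t₀` reduces to the point at infinity, as does the point at
infinity itself. -/
def specialization (A B : ℚ[X]) (t₀ : ℚ) (hE : (fiber A B t₀).IsElliptic) :
    (generic A B).Point → (fiber A B t₀).Point
  | .zero => .zero
  | .some x y h =>
      if hx : x.denom.eval t₀ = 0 then .zero
      else .some (value t₀ x) (value t₀ y)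
        ((fiber A B t₀).equation_iff_nonsingular.1 (equation_value h.1 hx))

/-- The coefficient `A(t) = -(t² + 27)`. -/
def coeffA : ℚ[X] := -(X ^ 2 + 27)

/-- The coefficient `B(t) = 10t² + 48t + 90`. -/
def coeffB : ℚ[X] := 10 * X ^ 2 + 48 * X + 90

theorem algebraMap_coeffA :
    algebraMap ℚ[X] (RatFunc ℚ) coeffA = -(RatFunc.X ^ 2 + 27) := by
  simp [coeffA, map_ofNat (algebraMap ℚ[X] (RatFunc ℚ))]

theorem algebraMap_coeffB :
    algebraMap ℚ[X] (RatFunc ℚ) coeffB = 10 * RatFunc.X ^ 2 + 48 * RatFunc.X + 90 := by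
  simp [coeffB, map_ofNat (algebraMap ℚ[X] (RatFunc ℚ))]

theorem linear_ne_zero (a b : ℚ[X]) (h : (a * X + b).eval 1 ≠ 0) :
    algebraMap ℚ[X] (RatFunc ℚ) a * RatFunc.X + algebraMap ℚ[X] (RatFunc ℚ) b ≠ 0 := by
  intro h0
  have : a * X + b = 0 := by
    apply RatFunc.algebraMap_injective ℚ
    simpa using h0
  simp [this] at h

theorem nonsingular_P :
    (generic coeffA coeffB).Nonsingular (RatFunc.X + 3) (4 * RatFunc.X + 6) := by
  rw [WeierstrassCurve.Affine.nonsingular_iff, WeierstrassCurve.Affine.equation_iff]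
  simp only [generic, algebraMap_coeffA, algebraMap_coeffB]
  refine ⟨by ring, Or.inr fun h => ?_⟩
  have h1 := linear_ne_zero 8 12 (by norm_num)
  simp only [map_ofNat] at h1
  exact h1 (by linear_combination h)

theorem nonsingular_Q :
    (generic coeffA coeffB).Nonsingular 9 (RatFunc.X + 24) := by
  rw [WeierstrassCurve.Affine.nonsingular_iff, WeierstrassCurve.Affine.equation_iff]
  simp only [generic, algebraMap_coeffA, algebraMap_coeffB]
  refine ⟨by ring, Or.inr fun h => ?_⟩
  have h1 := linear_ne_zero 2 48 (by norm_num)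
  simp only [map_ofNat] at h1
  exact h1 (by linear_combination h)

/-- The point `P = (t + 3, 4t + 6)`. -/
def pointP : (generic coeffA coeffB).Point := .some (RatFunc.X + 3) (4 * RatFunc.X + 6) nonsingular_P

/-- The point `Q = (9, t + 24)`. -/
def pointQ : (generic coeffA coeffB).Point := .some 9 (RatFunc.X + 24) nonsingular_Q

open Classical in
/-- The subgroup `M` of `E(ℚ(t))` generated by `P` and `Q`. -/
def subgroupM : AddSubgroup (generic coeffA coeffB).Point := AddSubgroup.closure {pointP, pointQ}

end EllipticSpecialization

end

/-! Specialization is a homomorphism, so it is enough that the specialized points `P₀` and `Q₀`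
satisfy no nontrivial relation `aP₀ + bQ₀ = 0`. As the cubic has no rational root, `E_{t₀}(ℚ)` has
no 2-torsion, and a nontrivial relation can be halved until a coefficient is odd. One of `P₀`, `Q₀`,
`P₀ + Q₀` is then divisible by two (`eq_zero_of_not_divisible`).

If one of them is `2R`, the slope `l` of the tangent at `R` is a root of a quartic
(`exists_tangent_slope`) that is also quadratic in `t₀`. Completing the square in `t₀` gives a
rational point on a genus one curve `w² = f(l)` independent of `t₀`, where `f` has four rational
roots. This curve is birational to `y² = x(x + a)(x + b)` with `(a, b)` equal to `(16, 30)`, `(7,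
12)` or `(8, 50)`. Those have no affine rational points with `y ≠ 0`, so `l` is a root of `f`, and
the resulting `t₀` are the ten excluded values.

The statement on the three curves (`y_eq_zero`) is an infinite descent. Doubling a point with `y ≠
0` makes `x`, `x + a`, `x + b` squares. By 2-descent such a point has a half with the same property,
and its denominator drops outside finitely many cases.

For the homomorphism property, three points with sum zero are treated as the intersection with a
line, whose reduction is controlled in the local ring of `ℚ(t)` at `t₀`. -/

open Polynomial

/-! ### Complete two-descent on `y² = x(x + a)(x + b)` -/

namespace TwoDescent

/-- The integers `±d` with `d ∣ k` and `d` squarefree. -/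
def signedDivisors (k : ℕ) : List ℤ :=
  ((List.range (k + 1)).filter fun d => k % d == 0 &&
    (List.range (d + 1)).all fun e => e < 2 || d % (e * e) != 0).flatMap
      fun d : ℕ => [(d : ℤ), -(d : ℤ)]

/-- There are no solutions modulo `N` of `d₁u² + an² = d₂v²`, `d₁u² + bn² = d₃w²` in which `p` does
not divide both `u` and `n`. -/
def obstructed (a b d₁ d₂ d₃ : ℤ) (p N : ℕ) : Bool :=
  (List.range N).all fun u => (List.range N).all fun n =>
    (u % p == 0 && n % p == 0) ||
    !(((List.range N).any fun v => ((d₁ % N).toNat * (u * u) + (a % N).toNat * (n * n)) % N ==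
        (d₂ % N).toNat * (v * v) % N) &&
      ((List.range N).any fun w => ((d₁ % N).toNat * (u * u) + (b % N).toNat * (n * n)) % N ==
        (d₃ % N).toNat * (w * w) % N))

/-- All pairs of square classes outside `T` are excluded by signs or by a local obstruction. -/
def descentCheck (a b : ℤ) (T : List (ℤ × ℤ)) : Bool :=
  (signedDivisors (a * b).natAbs).all fun d₁ => (signedDivisors (a * (b - a)).natAbs).all fun d₂ =>
    d₁ * d₂ < 0 || T.contains (d₁, d₂) ||
    -- The quotient by the gcd is the squarefree part of `d₁ * d₂`, that is, the class `d₃` of `x +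
    -- b`.
    (b * (b - a)) % (d₁ / Int.gcd d₁ d₂ * (d₂ / Int.gcd d₁ d₂)) != 0 ||
    [(3, 3), (5, 5), (7, 7), (2, 8), (3, 9), (2, 16), (5, 25)].any fun q =>
      obstructed a b d₁ d₂ (d₁ / Int.gcd d₁ d₂ * (d₂ / Int.gcd d₁ d₂)) q.1 q.2

-- In this and the next two checks, the surviving pairs are the squarefree classes of `(x, x + a)`
-- at infinity, `(0, 0)`, `(-a, 0)` and `(-b, 0)`, in this order.
set_option maxRecDepth 100000 in
theorem descentCheck_sixteen_thirty :
    descentCheck 16 30 [(1, 1), (30, 1), (-1, -14), (-30, -14)] = true := by decide +kernel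

set_option maxRecDepth 100000 in
theorem descentCheck_seven_twelve :
    descentCheck 7 12 [(1, 1), (21, 7), (-7, -35), (-3, -5)] = true := by decide +kernel

set_option maxRecDepth 100000 in
theorem descentCheck_eight_fifty :
    descentCheck 8 50 [(1, 1), (1, 2), (-2, -21), (-2, -42)] = true := by decide +kernel

/-! ### Soundness of the finite checks -/

theorem mem_signedDivisors {k : ℕ} (hk : k ≠ 0) {d : ℤ} (hd : Squarefree d) (h : d ∣ (k : ℤ)) :
    d ∈ signedDivisors k := by
  have hdk : d.natAbs ∣ k := Int.natCast_dvd_natCast.1 (by simpa using h)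
  have hsq : Squarefree d.natAbs := Int.squarefree_natAbs.2 hd
  simp only [signedDivisors, List.mem_flatMap, List.mem_filter, List.mem_range]
  refine ⟨d.natAbs, ⟨Nat.lt_succ_of_le (Nat.le_of_dvd (Nat.pos_of_ne_zero hk) hdk), ?_⟩, ?_⟩
  · simp only [Bool.and_eq_true, beq_iff_eq, List.all_eq_true, List.mem_range, Bool.or_eq_true,
      decide_eq_true_eq, bne_iff_ne]
    refine ⟨Nat.mod_eq_zero_of_dvd hdk, fun e _ => ?_⟩
    by_contra! hcon
    have := Nat.isUnit_iff.1 (hsq e (Nat.dvd_of_mod_eq_zero hcon.2))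
    omega
  · simp only [List.mem_cons, List.not_mem_nil, or_false]
    omega

theorem toNat_emod_cast (N : ℕ) [NeZero N] (x : ℤ) : ((x % N).toNat : ZMod N) = (x : ZMod N) := by
  have h : (((x % N).toNat : ℤ)) = x % N :=
    Int.toNat_of_nonneg (Int.emod_nonneg x (by exact_mod_cast NeZero.ne N))
  have h2 : (((x % N).toNat : ℤ) : ZMod N) = ((x % N : ℤ) : ZMod N) := by rw [h]
  rw [ZMod.intCast_mod] at h2
  exact_mod_cast h2

theorem obstructed_sound {a b d₁ d₂ d₃ : ℤ} {p N : ℕ} (hN : N ≠ 0) (hp : 1 < p) (hpN : p ∣ N)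
    (h : obstructed a b d₁ d₂ d₃ p N = true) {u v w n : ℤ} (hun : IsCoprime u n)
    (h₁ : d₁ * u ^ 2 + a * n ^ 2 = d₂ * v ^ 2) (h₂ : d₁ * u ^ 2 + b * n ^ 2 = d₃ * w ^ 2) :
    False := by
  have : NeZero N := ⟨hN⟩
  have hlt (x : ℤ) : (x % N).toNat < N := by
    have := Int.emod_lt_of_pos x (b := (N : ℤ)) (by omega)
    omega
  have hdvd (x : ℤ) (hx : (x % N).toNat % p = 0) : (p : ℤ) ∣ x := by
    have h1 : (p : ℤ) ∣ x % N := by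
      have := Int.natCast_dvd_natCast.2 (Nat.dvd_of_mod_eq_zero hx)
      rwa [Int.toNat_of_nonneg (Int.emod_nonneg x (by exact_mod_cast hN))] at this
    exact (Int.dvd_iff_emod_eq_zero.2 (by
      rw [← Int.emod_emod_of_dvd x (Int.natCast_dvd_natCast.2 hpN)]
      exact Int.emod_eq_zero_of_dvd h1))
  have key (c d z : ℤ) (hz : d₁ * u ^ 2 + c * n ^ 2 = d * z ^ 2) :
      ((d₁ % N).toNat * ((u % N).toNat * (u % N).toNat) +
        (c % N).toNat * ((n % N).toNat * (n % N).toNat)) % N =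
      (d % N).toNat * ((z % N).toNat * (z % N).toNat) % N := by
    apply (ZMod.natCast_eq_natCast_iff _ _ _).1
    push_cast
    simp only [toNat_emod_cast]
    have := congrArg (Int.cast : ℤ → ZMod N) hz
    push_cast at this
    linear_combination this
  simp only [obstructed, List.all_eq_true, List.mem_range, Bool.or_eq_true, Bool.and_eq_true,
    beq_iff_eq, Bool.not_eq_true', Bool.and_eq_false_iff, List.any_eq_false] at h
  rcases h _ (hlt u) _ (hlt n) with ⟨hu, hn⟩ | hv | hw
  · have := hun.isUnit_of_dvd' (hdvd u hu) (hdvd n hn)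
    rw [Int.isUnit_iff] at this
    omega
  · exact hv _ (hlt v) (key a d₂ v h₁)
  · exact hw _ (hlt w) (key b d₃ w h₂)

/-! ### Square classes of the three factors -/

theorem exists_squarefree_mul_sq {m : ℤ} (hm : m ≠ 0) :
    ∃ d u : ℤ, Squarefree d ∧ u ≠ 0 ∧ m = d * u ^ 2 := by
  obtain ⟨a, b, hab, ha⟩ := Nat.sq_mul_squarefree m.natAbs
  have hb : (b : ℤ) ≠ 0 := by
    rintro hb
    have : b = 0 := by exact_mod_cast hb
    subst this
    simp at hab
    omega
  have hab' : (m.natAbs : ℤ) = a * (b : ℤ) ^ 2 := by rw [← hab]; push_cast; ring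
  have ha' : Squarefree (a : ℤ) := Int.squarefree_natCast.2 ha
  rcases Int.natAbs_eq m with h | h
  · exact ⟨a, b, ha', hb, by rw [h, hab']⟩
  · refine ⟨-a, b, ?_, hb, by rw [h, hab']; ring⟩
    exact (Int.squarefree_natAbs).1 (by simpa using ha)

/-- If `d u² k` is a square with `d` squarefree, then `d ∣ k`. -/
theorem dvd_of_squarefree_mul_sq {d u k y : ℤ} (hd : Squarefree d) (hu : u ≠ 0)
    (h : y ^ 2 = d * u ^ 2 * k) : d ∣ k := by
  have h1 : u ^ 2 ∣ y ^ 2 := ⟨d * k, by rw [h]; ring⟩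
  obtain ⟨z, rfl⟩ := (Int.pow_dvd_pow_iff two_ne_zero).1 h1
  have h2 : z ^ 2 = d * k := by
    apply mul_left_cancel₀ (pow_ne_zero 2 hu)
    linear_combination h
  obtain ⟨c, rfl⟩ := (hd.dvd_pow_iff_dvd two_ne_zero).1 ⟨k, h2⟩
  refine ⟨c ^ 2, mul_left_cancel₀ hd.ne_zero ?_⟩
  linear_combination -h2

theorem eq_of_squarefree {d e y : ℤ} (hd : Squarefree d) (he : Squarefree e)
    (h : y ^ 2 = d * e) : d = e := by
  have h1 : d ∣ e := dvd_of_squarefree_mul_sq hd one_ne_zero (y := y)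
    (by rw [h]; ring)
  have h2 : e ∣ d := dvd_of_squarefree_mul_sq he one_ne_zero (y := y)
    (by rw [h]; ring)
  rcases Int.natAbs_eq_natAbs_iff.1 (Nat.dvd_antisymm (Int.natAbs_dvd_natAbs.2 h1)
    (Int.natAbs_dvd_natAbs.2 h2)) with h3 | h3
  · exact h3
  · subst h3
    have := he.ne_zero
    have : 0 < e ^ 2 := by positivity
    nlinarith [sq_nonneg y]

/-- The square class of a product of two squarefree integers. -/
theorem eq_of_squarefree_triple {d₁ d₂ d₃ y : ℤ} (h₁ : Squarefree d₁) (h₂ : Squarefree d₂)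
    (h₃ : Squarefree d₃) (h : y ^ 2 = d₁ * d₂ * d₃) :
    d₃ = d₁ / Int.gcd d₁ d₂ * (d₂ / Int.gcd d₁ d₂) := by
  have hg : (Int.gcd d₁ d₂ : ℤ) ≠ 0 := by
    have := Int.gcd_ne_zero_left (b := d₂) h₁.ne_zero
    exact_mod_cast this
  obtain ⟨e₁, he₁⟩ := Int.gcd_dvd_left d₁ d₂
  obtain ⟨e₂, he₂⟩ := Int.gcd_dvd_right d₁ d₂
  have hq₁ : d₁ / Int.gcd d₁ d₂ = e₁ := by
    conv_lhs => arg 1; rw [he₁]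
    exact Int.mul_ediv_cancel_left _ hg
  have hq₂ : d₂ / Int.gcd d₁ d₂ = e₂ := by
    conv_lhs => arg 1; rw [he₂]
    exact Int.mul_ediv_cancel_left _ hg
  have hcop : IsCoprime e₁ e₂ := by
    rw [← hq₁, ← hq₂, Int.isCoprime_iff_gcd_eq_one]
    exact Int.gcd_ediv_gcd_ediv_gcd (Nat.pos_of_ne_zero (by exact_mod_cast hg))
  rw [hq₁, hq₂]
  have hs : Squarefree (e₁ * e₂) := by
    rw [squarefree_mul_iff]
    exact ⟨hcop.isRelPrime, h₁.squarefree_of_dvd ⟨_, by rw [mul_comm]; exact he₁⟩,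
      h₂.squarefree_of_dvd ⟨_, by rw [mul_comm]; exact he₂⟩⟩
  have h4 : y ^ 2 = (Int.gcd d₁ d₂ : ℤ) ^ 2 * (e₁ * e₂ * d₃) := by
    calc y ^ 2 = d₁ * d₂ * d₃ := h
      _ = (Int.gcd d₁ d₂ * e₁) * (Int.gcd d₁ d₂ * e₂) * d₃ := by rw [← he₁, ← he₂]
      _ = _ := by ring
  obtain ⟨z, rfl⟩ := (Int.pow_dvd_pow_iff two_ne_zero).1 ⟨_, h4⟩
  refine (eq_of_squarefree (y := z) hs h₃ ?_).symm
  apply mul_left_cancel₀ (pow_ne_zero 2 hg)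
  linear_combination h4

/-- Modulo `m` the two other factors multiply to `a * b * n ^ 4`, and `d`, as a divisor of `m`, is
prime to `n`. -/
theorem dvd_mul_of_coprime {a b m n d u y : ℤ} (hmn : IsCoprime m n) (hd : Squarefree d)
    (hu : u ≠ 0) (hm : m = d * u ^ 2) (h : y ^ 2 = m * ((m + a * n ^ 2) * (m + b * n ^ 2))) :
    d ∣ a * b := by
  have h1 : d ∣ (m + a * n ^ 2) * (m + b * n ^ 2) :=
    dvd_of_squarefree_mul_sq hd hu (by rw [h, hm])
  have h2 : d ∣ m := ⟨u ^ 2, hm⟩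
  have h3 : d ∣ a * b * n ^ 4 := by
    have : a * b * n ^ 4 = (m + a * n ^ 2) * (m + b * n ^ 2) -
        m * (m + a * n ^ 2 + b * n ^ 2) := by ring
    rw [this]
    exact dvd_sub h1 (h2.mul_right _)
  exact ((hmn.of_isCoprime_of_dvd_left h2).pow_right).dvd_of_dvd_mul_right h3

/-- A rational point on `y² = x(x + a)(x + b)` in integral form. -/
theorem exists_integral_form {a b : ℤ} {x y : ℚ} (h : y ^ 2 = x * (x + a) * (x + b)) :
    ∃ m n z : ℤ, n ≠ 0 ∧ IsCoprime m n ∧ x = m / n ^ 2 ∧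
      z ^ 2 = m * ((m + a * n ^ 2) * (m + b * n ^ 2)) := by
  have hN : (x.den : ℚ) ≠ 0 := by exact_mod_cast x.den_nz
  have hx : x = x.num / x.den := (Rat.num_div_den x).symm
  have hsq : IsSquare
      (((x.den : ℤ) * (x.num * (x.num + a * x.den) * (x.num + b * x.den)) : ℤ) : ℚ) := by
    refine ⟨y * x.den ^ 2, ?_⟩
    have h1 : x.den * x = x.num := Rat.den_mul_eq_num x
    push_cast
    rw [← h1]
    linear_combination -(x.den : ℚ) ^ 4 * h
  rw [Rat.isSquare_intCast_iff] at hsq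
  obtain ⟨Y, hY⟩ := hsq
  have hc : IsCoprime (x.den : ℤ) x.num := x.isCoprime_num_den.symm
  have hc2 (c : ℤ) : IsCoprime (x.den : ℤ) (x.num + c * x.den) :=
    (IsCoprime.add_mul_right_right_iff).2 hc
  -- The denominator is prime to all three numerators and its product with them is a square, so up
  -- to sign it is a square.
  obtain ⟨n, hn⟩ := Int.sq_of_isCoprime ((hc.mul_right (hc2 a)).mul_right (hc2 b))
    (by rw [hY, sq])
  have hn' : (x.den : ℤ) = n ^ 2 := by
    rcases hn with hn | hn
    · exact hn
    · have := x.den_pos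
      nlinarith [sq_nonneg n]
  have hn0 : n ≠ 0 := by
    rintro rfl
    have := x.den_pos
    simp at hn'
  rw [hn'] at hY hc
  obtain ⟨z, rfl⟩ : n ∣ Y := (Int.pow_dvd_pow_iff two_ne_zero).1 ⟨_, by rw [sq Y, ← hY]⟩
  refine ⟨x.num, n, z, hn0, (IsCoprime.pow_left_iff two_pos).1 hc |>.symm, ?_, ?_⟩
  · conv_lhs => rw [hx]
    rw [show (x.den : ℚ) = ((x.den : ℤ) : ℚ) by norm_cast, hn']
    push_cast
    rfl
  · apply mul_left_cancel₀ (pow_ne_zero 2 hn0)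
    linear_combination -hY

/-- The squarefree parts of the three factors divide `a * b`, `a * (b - a)`, `b * (b - a)`, which
leaves finitely many classes. Each class outside `T` contradicts the signs, the divisibility by
`d₃`, or solvability modulo a prime power with `u`, `n` coprime. -/
theorem exists_mem_isSquare {a b : ℤ} (ha : 0 < a) (hab : a < b) {T : List (ℤ × ℤ)}
    (hc : descentCheck a b T = true) {x y : ℚ} (hy : y ≠ 0) (h : y ^ 2 = x * (x + a) * (x + b)) :
    ∃ q ∈ T, IsSquare (q.1 * x) ∧ IsSquare (q.2 * (x + a)) := by
  obtain ⟨m, n, z, hn, hmn, hx, hz⟩ := exists_integral_form h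
  have hn' : (n : ℚ) ≠ 0 := by exact_mod_cast hn
  have hz0 : z ≠ 0 := by
    rintro rfl
    have h1 : ((0 : ℤ) : ℚ) ^ 2 = ((m * ((m + a * n ^ 2) * (m + b * n ^ 2)) : ℤ) : ℚ) := by
      rw [← hz]; norm_num
    push_cast at h1
    have hm : (m : ℚ) = n ^ 2 * x := by rw [hx]; field_simp
    have : ((n : ℚ) ^ 3 * y) ^ 2 = 0 := by
      rw [hm] at h1
      linear_combination (n : ℚ) ^ 6 * h - h1
    simp [hn', hy] at this
  have hz2 : 0 < m * ((m + a * n ^ 2) * (m + b * n ^ 2)) := by rw [← hz]; positivity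
  obtain ⟨hm0, h20, h30⟩ : m ≠ 0 ∧ m + a * n ^ 2 ≠ 0 ∧ m + b * n ^ 2 ≠ 0 := by
    refine ⟨?_, ?_, ?_⟩ <;> intro h0 <;> simp [h0] at hz2
  obtain ⟨d₁, u, hd₁, hu, hm⟩ := exists_squarefree_mul_sq hm0
  obtain ⟨d₂, v, hd₂, hv, hm₂⟩ := exists_squarefree_mul_sq h20
  obtain ⟨d₃, w, hd₃, hw, hm₃⟩ := exists_squarefree_mul_sq h30
  have hdvd₁ : d₁ ∣ a * b := dvd_mul_of_coprime hmn hd₁ hu hm hz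
  -- Moving the origin to the root `-a` replaces the shifts `a`, `b` by `-a`, `b - a`.
  have hdvd₂ : d₂ ∣ a * (b - a) := by
    have := dvd_mul_of_coprime (a := -a) (b := b - a) (n := n) (y := z)
      (IsCoprime.add_mul_right_left_iff.2 hmn : IsCoprime (m + a * n * n) n) hd₂ hv
      (by linear_combination hm₂) (by linear_combination hz)
    rwa [neg_mul, dvd_neg] at this
  have hdvd₃ : d₃ ∣ b * (b - a) := by
    have := dvd_mul_of_coprime (a := -b) (b := a - b) (n := n) (y := z)
      (IsCoprime.add_mul_right_left_iff.2 hmn : IsCoprime (m + b * n * n) n) hd₃ hw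
      (by linear_combination hm₃) (by linear_combination hz)
    convert this using 1
    ring
  have huvw : u * v * w ≠ 0 := by positivity
  have hprod : z ^ 2 = (u * v * w) ^ 2 * (d₁ * d₂ * d₃) := by
    rw [hz, hm₂, hm₃]
    conv_lhs => rw [hm]
    ring
  obtain ⟨c, rfl⟩ := (Int.pow_dvd_pow_iff two_ne_zero).1 ⟨_, hprod⟩
  have hc3 : c ^ 2 = d₁ * d₂ * d₃ := by
    apply mul_left_cancel₀ (pow_ne_zero 2 huvw)
    linear_combination hprod
  have hd₃eq := eq_of_squarefree_triple hd₁ hd₂ hd₃ hc3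
  have hun : IsCoprime u n := by
    refine hmn.of_isCoprime_of_dvd_left ⟨d₁ * u, ?_⟩
    rw [hm]; ring
  simp only [descentCheck, List.all_eq_true] at hc
  have hc := hc d₁ (mem_signedDivisors (by simp; omega) hd₁ (Int.dvd_natAbs.2 hdvd₁))
    d₂ (mem_signedDivisors (by simp; omega) hd₂ (Int.dvd_natAbs.2 hdvd₂))
  rw [← hd₃eq] at hc
  simp only [Bool.or_eq_true, decide_eq_true_eq, bne_iff_ne] at hc
  rcases hc with ((hc | hc) | hc) | hc
  -- If `x` and `x + a` have opposite signs, then `x < 0 < x + a < x + b`, and the product cannot be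
  -- a square.
  · exfalso
    have hn2 : 0 < n ^ 2 := by positivity
    have h1 : m * (m + a * n ^ 2) < 0 := by
      have : 0 < (u * v) ^ 2 := by positivity
      rw [hm₂, hm]
      nlinarith
    have h2 : m + b * n ^ 2 < 0 := by nlinarith
    have h3 : m + a * n ^ 2 < 0 := by nlinarith
    have h4 : m < 0 := by nlinarith
    exact (mul_pos_of_neg_of_neg h4 h3).not_gt h1
  · refine ⟨(d₁, d₂), by simpa using hc, ⟨d₁ * u / n, ?_⟩, ⟨d₂ * v / n, ?_⟩⟩
    · rw [hx, hm]; push_cast; field_simp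
    · have hm₂' : (m : ℚ) + a * n ^ 2 = d₂ * v ^ 2 := by exact_mod_cast hm₂
      rw [hx]
      field_simp
      linear_combination (d₂ : ℚ) * hm₂'
  · exact absurd (Int.emod_eq_zero_of_dvd hdvd₃) hc
  · exfalso
    obtain ⟨q, hq, hobs⟩ := List.any_eq_true.1 hc
    have hq' : q.2 ≠ 0 ∧ 1 < q.1 ∧ q.1 ∣ q.2 := by
      simp only [List.mem_cons, List.not_mem_nil, or_false] at hq
      rcases hq with rfl | rfl | rfl | rfl | rfl | rfl | rfl <;> decide
    exact obstructed_sound hq'.1 hq'.2.1 hq'.2.2 hobs hun (by rw [← hm, hm₂])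
      (by rw [← hm, hm₃])

/-! ### Infinite descent by halving -/

theorem isSquare_of_mul {p q : ℚ} (hp : p ≠ 0) (h : IsSquare p) (hpq : IsSquare (p * q)) :
    IsSquare q := by
  have : q = p * q / p := by field_simp
  rw [this]
  exact hpq.div h

/-- The square classes of `(x, x + a)` coming from the two-torsion points of
`y² = x(x + a)(x + b)`. -/
def IsTorsionClass (a b : ℤ) (q : ℤ × ℤ) : Prop :=
  q.1 ≠ 0 ∧ q.2 ≠ 0 ∧
  ((IsSquare q.1 ∧ IsSquare q.2) ∨ (IsSquare (q.1 * (a * b)) ∧ IsSquare (q.2 * a)) ∨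
  (IsSquare (q.1 * -a) ∧ IsSquare (q.2 * (a * (a - b)))) ∨
  (IsSquare (q.1 * -b) ∧ IsSquare (q.2 * (a - b))))

theorem isSquare_mul_of_mem {a b : ℤ} (ha : 0 < a) (hab : a < b) {T : List (ℤ × ℤ)}
    (hc : descentCheck a b T = true) (hT : ∀ q ∈ T, IsTorsionClass a b q) {x y : ℚ} (hy : y ≠ 0)
    (h : y ^ 2 = x * (x + a) * (x + b)) :
    (IsSquare x ∧ IsSquare (x + a)) ∨ (IsSquare (a * b * x) ∧ IsSquare (a * (x + a))) ∨
    (IsSquare (-a * x) ∧ IsSquare (a * (a - b) * (x + a))) ∨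
    (IsSquare (-b * x) ∧ IsSquare ((a - b) * (x + a))) := by
  have key {q c : ℤ} {z : ℚ} (hz : z ≠ 0) (h1 : IsSquare (q * z)) (hq : q ≠ 0)
      (h2 : IsSquare (q * c)) : IsSquare (c * z) := by
    have hq' : (q : ℚ) ≠ 0 := by exact_mod_cast hq
    refine isSquare_of_mul (mul_ne_zero hq' hz) h1 ?_
    have h3 := (Rat.isSquare_intCast_iff.2 h2).mul (IsSquare.mul_self z)
    push_cast at h3
    have e : (q * z * (c * z) : ℚ) = q * c * (z * z) := by ring
    rwa [e]
  obtain ⟨q, hq, h1, h2⟩ := exists_mem_isSquare ha hab hc hy h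
  obtain ⟨hq1, hq2, hcl⟩ := hT q hq
  have hx : x ≠ 0 := by rintro rfl; simp [hy] at h
  have hxa : x + a ≠ 0 := by intro h0; simp [h0, hy] at h
  rcases hcl with ⟨e1, e2⟩ | ⟨e1, e2⟩ | ⟨e1, e2⟩ | ⟨e1, e2⟩
  · exact Or.inl ⟨by simpa using key (c := 1) hx h1 hq1 (by simpa using e1),
      by simpa using key (c := 1) hxa h2 hq2 (by simpa using e2)⟩
  · exact Or.inr (Or.inl ⟨by simpa using key hx h1 hq1 e1, key hxa h2 hq2 e2⟩)
  · exact Or.inr (Or.inr (Or.inl ⟨by simpa using key hx h1 hq1 e1,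
      by simpa using key hxa h2 hq2 e2⟩))
  · exact Or.inr (Or.inr (Or.inr ⟨by simpa using key hx h1 hq1 e1,
      by simpa using key hxa h2 hq2 e2⟩))

/-- Infinite descent: there is no affine point all of whose `x - eᵢ` are squares. -/
theorem no_square_solution {a b : ℤ} (ha : 0 < a) (hab : a < b) {T : List (ℤ × ℤ)}
    (hc : descentCheck a b T = true) (hT : ∀ q ∈ T, IsTorsionClass a b q)
    (hfin : ∀ A B C n : ℤ, A ∣ a → B ∣ b → C ∣ b - a → (C - B) * A = a * n ^ 2 →
      (C - A) * B = b * n ^ 2 → n = 0) (N : ℕ) :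
    ∀ u v w n : ℤ, n ≠ 0 → n.natAbs = N → v ^ 2 = u ^ 2 + a * n ^ 2 →
      w ^ 2 = u ^ 2 + b * n ^ 2 → False := by
  induction N using Nat.strong_induction_on with
  | _ N ih =>
  -- Here the half with `x`-coordinate `(u + v) * (u + w) / n ^ 2` again makes all three factors
  -- squares, over the same `n`. A common factor of `s` and `n` gives a smaller denominator.
  -- Otherwise `u + v`, `u + w`, `v + w` are prime to `n`, hence divide `a`, `b`, `b - a`, and
  -- `hfin` applies.
  have descent : ∀ u v w n : ℤ, n ≠ 0 → n.natAbs = N → v ^ 2 = u ^ 2 + a * n ^ 2 →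
      w ^ 2 = u ^ 2 + b * n ^ 2 → IsSquare (((u + v) * (u + w) : ℤ) : ℚ) →
      IsSquare (((u + v) * (v + w) : ℤ) : ℚ) → False := by
    intro u v w n hn hnN hv hw hs ht
    obtain ⟨s, hs⟩ := Rat.isSquare_intCast_iff.1 hs
    obtain ⟨t, ht⟩ := Rat.isSquare_intCast_iff.1 ht
    have huv : u + v ≠ 0 := by
      intro h0
      have : a * n ^ 2 = 0 := by linear_combination -hv + (v - u) * h0
      simp [hn, ha.ne'] at this
    obtain ⟨z, hz⟩ : IsSquare ((u + w) * (v + w)) := by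
      rw [← Rat.isSquare_intCast_iff]
      have huv' : ((u : ℚ) + v) ≠ 0 := by exact_mod_cast huv
      refine ⟨s * t / (u + v), ?_⟩
      have hs' : ((u : ℚ) + v) * (u + w) = s * s := by exact_mod_cast hs
      have ht' : ((u : ℚ) + v) * (v + w) = t * t := by exact_mod_cast ht
      push_cast
      field_simp
      linear_combination (u + v : ℚ) * (v + w) * hs' + s ^ 2 * ht'
    have hst : t ^ 2 = s ^ 2 + a * n ^ 2 := by linear_combination hs - ht + hv
    have hsz : z ^ 2 = s ^ 2 + b * n ^ 2 := by linear_combination hs - hz + hw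
    have hg0 : (Int.gcd s n : ℤ) ≠ 0 := by
      exact_mod_cast Int.gcd_ne_zero_right hn
    by_cases hg : Int.gcd s n = 1
    · have hcs : IsCoprime s n := Int.isCoprime_iff_gcd_eq_one.2 hg
      have hct : IsCoprime t n := by
        rw [← IsCoprime.pow_left_iff two_pos, hst, sq n, ← mul_assoc]
        exact IsCoprime.add_mul_right_left_iff.2 hcs.pow_left
      have hcz : IsCoprime z n := by
        rw [← IsCoprime.pow_left_iff two_pos, hsz, sq n, ← mul_assoc]
        exact IsCoprime.add_mul_right_left_iff.2 hcs.pow_left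
      have aux {k l e r c : ℤ} (hkl : k * l = r * r) (hr : IsCoprime r n)
          (hke : e * k = c * n ^ 2) : k ∣ c := by
        have : IsCoprime k n :=
          (hr.mul_left hr).of_isCoprime_of_dvd_left ⟨l, hkl.symm⟩
        exact this.pow_right.dvd_of_dvd_mul_right ⟨e, by rw [← hke]; ring⟩
      refine hn (hfin (u + v) (u + w) (v + w) n
        (aux (e := v - u) hs hcs (by linear_combination hv))
        (aux (e := w - u) (l := u + v) (r := s) (by linear_combination hs) hcs
          (by linear_combination hw))
        (aux (e := w - v) (l := u + v) (r := t) (by linear_combination ht) hct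
          (by linear_combination hw - hv))
        (by linear_combination hv) (by linear_combination hw))
    · obtain ⟨s', hs'⟩ := Int.gcd_dvd_left s n
      obtain ⟨n', hn'⟩ := Int.gcd_dvd_right s n
      generalize hG : Int.gcd s n = G at *
      subst hs' hn'
      obtain ⟨t', rfl⟩ : (G : ℤ) ∣ t := (Int.pow_dvd_pow_iff two_ne_zero).1
        ⟨s' ^ 2 + a * n' ^ 2, by rw [hst]; ring⟩
      obtain ⟨z', rfl⟩ : (G : ℤ) ∣ z := (Int.pow_dvd_pow_iff two_ne_zero).1
        ⟨s' ^ 2 + b * n' ^ 2, by rw [hsz]; ring⟩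
      have hn0 : n' ≠ 0 := right_ne_zero_of_mul hn
      refine ih n'.natAbs ?_ s' t' z' n' hn0 rfl ?_ ?_
      · rw [← hnN, Int.natAbs_mul, Int.natAbs_natCast]
        have h1 : 0 < n'.natAbs := Int.natAbs_pos.2 hn0
        have h2 : G ≠ 0 := by exact_mod_cast hg0
        have h3 : 2 ≤ G := by omega
        nlinarith
      · apply mul_left_cancel₀ (pow_ne_zero 2 hg0)
        linear_combination hst
      · apply mul_left_cancel₀ (pow_ne_zero 2 hg0)
        linear_combination hsz
  intro u v w n hn hnN hv hw
  have hn' : (n : ℚ) ≠ 0 := by exact_mod_cast hn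
  have haq : (a : ℚ) ≠ 0 := by exact_mod_cast ha.ne'
  have hbq : (b : ℚ) ≠ 0 := by exact_mod_cast (ha.trans hab).ne'
  have habq : (a : ℚ) - b ≠ 0 := sub_ne_zero.2 (by exact_mod_cast hab.ne)
  have hv' : (v : ℚ) ^ 2 = u ^ 2 + a * n ^ 2 := by exact_mod_cast hv
  have hw' : (w : ℚ) ^ 2 = u ^ 2 + b * n ^ 2 := by exact_mod_cast hw
  have huv : (u : ℚ) + v ≠ 0 := by
    intro h0
    have : a * (n : ℚ) ^ 2 = 0 := by linear_combination -hv' + (v - u) * h0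
    simp [hn', haq] at this
  have huw : (u : ℚ) + w ≠ 0 := by
    intro h0
    have : b * (n : ℚ) ^ 2 = 0 := by linear_combination -hw' + (w - u) * h0
    simp [hn', hbq] at this
  have hvw : (v : ℚ) + w ≠ 0 := by
    intro h0
    have : (a - b) * (n : ℚ) ^ 2 = 0 := by linear_combination hw' - hv' + (v - w) * h0
    simp [hn', habq] at this
  -- For a point with `x = (u / n) ^ 2`, `x + a = (v / n) ^ 2`, `x + b = (w / n) ^ 2`, a half has
  -- `x`-coordinate `(u + v) * (u + w) / n ^ 2`.
  have hxa : ((u + v) * (u + w) / n ^ 2 + a : ℚ) = (u + v) * (v + w) / n ^ 2 := by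
    field_simp
    linear_combination -hv'
  have hxb : ((u + v) * (u + w) / n ^ 2 + b : ℚ) = (u + w) * (v + w) / n ^ 2 := by
    field_simp
    linear_combination -hw'
  have hcl := isSquare_mul_of_mem ha hab hc hT (x := (u + v) * (u + w) / n ^ 2)
    (y := (u + v) * (u + w) * (v + w) / n ^ 3) (by positivity)
    (by rw [hxa, hxb]; field_simp)
  rw [hxa] at hcl
  have clear_denom {c k : ℚ} (h : IsSquare (c * (k / n ^ 2))) : IsSquare (c * k) := by
    have := h.mul (IsSquare.mul_self (n : ℚ))
    have e : c * k = c * (k / n ^ 2) * (n * n) := by field_simp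
    rwa [e]
  have hA : ((u : ℚ) + v) * (u - v) = -a * n ^ 2 := by linear_combination -hv'
  have hB : ((u : ℚ) + w) * (u - w) = -b * n ^ 2 := by linear_combination -hw'
  have hC : ((v : ℚ) + w) * (v - w) = (a - b) * n ^ 2 := by linear_combination hv' - hw'
  -- Flipping two of the signs of `u`, `v`, `w` passes to another half of the same point, a
  -- translate by 2-torsion. The flip is chosen so that the class becomes trivial.
  rcases hcl with ⟨h1, h2⟩ | ⟨h1, h2⟩ | ⟨h1, h2⟩ | ⟨h1, h2⟩
  · refine descent u v w n hn hnN hv hw ?_ ?_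
    · simpa using clear_denom (c := 1) (by simpa using h1)
    · simpa using clear_denom (c := 1) (by simpa using h2)
  · refine descent u (-v) (-w) n hn hnN (by linear_combination hv) (by linear_combination hw)
      (isSquare_of_mul (by simp [*]) (clear_denom h1) ⟨a * b * n ^ 2, ?_⟩)
      (isSquare_of_mul (by simp [*]) (clear_denom h2) ⟨a * n * (v + w), ?_⟩)
    · push_cast
      linear_combination (a : ℚ) * b * ((u + w) * (u - w)) * hA - a * b * (a * n ^ 2) * hB
    · push_cast
      linear_combination -(a : ℚ) * (v + w) ^ 2 * hA
  · refine descent (-u) v (-w) n hn hnN (by linear_combination hv) (by linear_combination hw)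
      (isSquare_of_mul (by simp [*]) (clear_denom h1) ⟨a * n * (u + w), ?_⟩)
      (isSquare_of_mul (by simp [*]) (clear_denom h2) ⟨a * (a - b) * n ^ 2, ?_⟩)
    · push_cast
      linear_combination -(a : ℚ) * (u + w) ^ 2 * hA
    · push_cast
      linear_combination a * (a - b) * (a * n ^ 2 * hC - (v + w) * (v - w) * hA)
  · refine descent (-u) (-v) w n hn hnN (by linear_combination hv) (by linear_combination hw)
      (isSquare_of_mul (by simp [*]) (clear_denom h1) ⟨b * n * (u + v), ?_⟩)
      (isSquare_of_mul (by simp [*]) (clear_denom h2) ⟨(a - b) * n * (u + v), ?_⟩)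
    · push_cast
      linear_combination -b * (u + v) ^ 2 * hB
    · push_cast
      linear_combination (a - b) * (u + v) ^ 2 * hC

/-- The double of `(x, y)` has `x`-coordinate `r ^ 2` with `r = (x ^ 2 - a * b) / (2 * y)`, and
adding `a` or `b` to it gives squares too, which `no_square_solution` forbids. -/
theorem y_eq_zero {a b : ℤ} (ha : 0 < a) (hab : a < b) {T : List (ℤ × ℤ)}
    (hc : descentCheck a b T = true) (hT : ∀ q ∈ T, IsTorsionClass a b q)
    (hfin : ∀ A B C n : ℤ, A ∣ a → B ∣ b → C ∣ b - a → (C - B) * A = a * n ^ 2 →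
      (C - A) * B = b * n ^ 2 → n = 0) {x y : ℚ} (h : y ^ 2 = x * (x + a) * (x + b)) : y = 0 := by
  by_contra hy
  set r : ℚ := (x ^ 2 - a * b) / (2 * y) with hr
  have hr0 : (r.den : ℚ) ≠ 0 := by exact_mod_cast r.den_nz
  have hden : r.den * r = r.num := Rat.den_mul_eq_num r
  have hsq {c : ℤ} {k : ℚ} (hk : r ^ 2 + c = k ^ 2) :
      IsSquare (r.num ^ 2 + c * (r.den : ℤ) ^ 2) := by
    rw [← Rat.isSquare_intCast_iff]
    refine ⟨r.den * k, ?_⟩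
    push_cast
    rw [← hden]
    linear_combination (r.den : ℚ) ^ 2 * hk
  obtain ⟨v, hv⟩ := hsq (c := a) (k := (x ^ 2 + 2 * a * x + a * b) / (2 * y)) (by
    rw [hr]
    field_simp
    rw [h]
    ring)
  obtain ⟨w, hw⟩ := hsq (c := b) (k := (x ^ 2 + 2 * b * x + a * b) / (2 * y)) (by
    rw [hr]
    field_simp
    rw [h]
    ring)
  exact no_square_solution ha hab hc hT hfin _ r.num v w r.den (by exact_mod_cast r.den_nz) rfl
    (by rw [hv, sq]) (by rw [hw, sq])

/-- The divisor equations that remain at the end of the descent have no solution with `n ≠ 0`, in a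
decidable form. -/
def FinalCheck (a b : ℤ) : Prop :=
  ∀ A ∈ Finset.Icc (-a) a, A ∣ a → ∀ B ∈ Finset.Icc (-b) b, B ∣ b →
    ∀ C ∈ Finset.Icc (-(b - a)) (b - a), C ∣ b - a →
      (C - B) * A * b = (C - A) * B * a → ∀ n ∈ Finset.Icc 1 b.natAbs,
        (C - B) * A ≠ a * (n : ℤ) ^ 2

/-- The divisors are bounded by `a`, `b`, `b - a`, so `n ^ 2 ≤ 2 * b`, which puts `|n|` in the range
searched. -/
theorem FinalCheck.eq_zero {a b : ℤ} (ha : 0 < a) (hab : a < b) (h : FinalCheck a b)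
    (A B C n : ℤ) (hA : A ∣ a) (hB : B ∣ b) (hC : C ∣ b - a) (h₁ : (C - B) * A = a * n ^ 2)
    (h₂ : (C - A) * B = b * n ^ 2) : n = 0 := by
  by_contra hn
  have bd {k c : ℤ} (hc : 0 < c) (hk : k ∣ c) : -c ≤ k ∧ k ≤ c :=
    ⟨by have := Int.le_of_dvd hc (neg_dvd.2 hk); omega, Int.le_of_dvd hc hk⟩
  have bA := bd ha hA
  have bB := bd (ha.trans hab) hB
  have bC := bd (sub_pos.2 hab) hC
  refine h A (Finset.mem_Icc.2 bA) hA B (Finset.mem_Icc.2 bB) hB C (Finset.mem_Icc.2 bC) hC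
    (by rw [h₁, h₂]; ring) n.natAbs (Finset.mem_Icc.2 ⟨Int.natAbs_pos.2 hn, ?_⟩) (by simpa using h₁)
  have h3 : n ^ 2 ≤ 2 * b := by
    have h4 : (C - B) * A ≤ 2 * b * a := by
      have h5 : |C - B| ≤ 2 * b := abs_le.2 ⟨by omega, by omega⟩
      have h6 : |A| ≤ a := abs_le.2 ⟨by omega, by omega⟩
      calc (C - B) * A ≤ |(C - B) * A| := le_abs_self _
        _ = |C - B| * |A| := abs_mul _ _
        _ ≤ 2 * b * a := by gcongr; omega
    nlinarith
  have h7 : ((n.natAbs : ℕ) : ℤ) ^ 2 = n ^ 2 := by simp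
  by_contra hlt
  have h8 : b + 1 ≤ (n.natAbs : ℤ) := by omega
  nlinarith

theorem no_nontrivial_point_sixteen_thirty {x y : ℚ} (h : y ^ 2 = x * (x + 16) * (x + 30)) :
    y = 0 := by
  refine y_eq_zero (a := 16) (b := 30) (by norm_num) (by norm_num) descentCheck_sixteen_thirty ?_
    (FinalCheck.eq_zero (by norm_num) (by norm_num) ?_) (x := x) (by push_cast; exact h)
  · unfold IsTorsionClass
    decide +kernel
  · unfold FinalCheck
    decide +kernel

theorem no_nontrivial_point_seven_twelve {x y : ℚ} (h : y ^ 2 = x * (x + 7) * (x + 12)) :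
    y = 0 := by
  refine y_eq_zero (a := 7) (b := 12) (by norm_num) (by norm_num) descentCheck_seven_twelve ?_
    (FinalCheck.eq_zero (by norm_num) (by norm_num) ?_) (x := x) (by push_cast; exact h)
  · unfold IsTorsionClass
    decide +kernel
  · unfold FinalCheck
    decide +kernel

theorem no_nontrivial_point_eight_fifty {x y : ℚ} (h : y ^ 2 = x * (x + 8) * (x + 50)) :
    y = 0 := by
  refine y_eq_zero (a := 8) (b := 50) (by norm_num) (by norm_num) descentCheck_eight_fifty ?_
    (FinalCheck.eq_zero (by norm_num) (by norm_num) ?_) (x := x) (by push_cast; exact h)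
  · unfold IsTorsionClass
    decide +kernel
  · unfold FinalCheck
    decide +kernel

/-! ### The quartics attached to halving -/

theorem quartic_eq_zero_P {l w : ℚ} (h : w ^ 2 = 8 * l * (l + 2) * (l + 3) * (l + 7)) : w = 0 := by
  by_cases hl : l = 0
  · subst hl
    simpa using h
  -- The root `l = 0` goes to infinity. The other factors become `84 / l + 42`, `84 / l + 28`, `84 /
  -- l + 12`, and the smallest is taken as `x`.
  · have := no_nontrivial_point_sixteen_thirty (x := 84 / l + 12) (y := 42 * w / l ^ 2) (by
      field_simp
      rw [h]
      ring)
    simpa [hl] using this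

theorem quartic_eq_zero_Q {l w : ℚ} (h : w ^ 2 = -(l + 1) * (l + 3) * (l + 5) * (l - 9)) :
    w = 0 := by
  by_cases hl : l + 1 = 0
  · simpa [hl] using h
  -- Here the root `-1` goes to infinity, with factors `20 / (l + 1)` plus `10`, `5`, `-2`.
  · have := no_nontrivial_point_seven_twelve (x := 20 / (l + 1) - 2) (y := 10 * w / (l + 1) ^ 2) (by
      field_simp
      rw [h]
      ring)
    simpa [hl] using this

theorem quartic_eq_zero_PQ {l w : ℚ} (h : w ^ 2 = 8 * l * (l + 2) * (l - 3) * (l - 5)) :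
    w = 0 := by
  by_cases hl : l = 0
  · subst hl
    simpa using h
  -- The factors are `60 / l` plus `30`, `-12`, `-20`.
  · have := no_nontrivial_point_eight_fifty (x := 60 / l - 20) (y := 30 * w / l ^ 2) (by
      field_simp
      rw [h]
      ring)
    simpa [hl] using this

end TwoDescent

namespace EllipticSpecialization

/-! ### Values of rational functions -/

/-- `f` has no pole at `t₀` and takes the value `c` there. -/
def HasValue (t₀ : ℚ) (f : RatFunc ℚ) (c : ℚ) : Prop :=
  f.denom.eval t₀ ≠ 0 ∧ value t₀ f = c

variable {t₀ : ℚ} {f g : RatFunc ℚ} {c d : ℚ}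

theorem hasValue_value (h : f.denom.eval t₀ ≠ 0) : HasValue t₀ f (value t₀ f) := ⟨h, rfl⟩

theorem HasValue.unique (hc : HasValue t₀ f c) (hd : HasValue t₀ f d) : c = d :=
  hc.2.symm.trans hd.2

theorem HasValue.add (hf : HasValue t₀ f c) (hg : HasValue t₀ g d) :
    HasValue t₀ (f + g) (c + d) := by
  obtain ⟨hf, rfl⟩ := hf
  obtain ⟨hg, rfl⟩ := hg
  refine ⟨fun h0 => ?_, RatFunc.eval_add (RingHom.id ℚ) t₀ hf hg⟩
  have := eval_eq_zero_of_dvd_of_eval_eq_zero (RatFunc.denom_add_dvd f g) h0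
  simp [hf, hg] at this

theorem HasValue.mul (hf : HasValue t₀ f c) (hg : HasValue t₀ g d) :
    HasValue t₀ (f * g) (c * d) := by
  obtain ⟨hf, rfl⟩ := hf
  obtain ⟨hg, rfl⟩ := hg
  refine ⟨fun h0 => ?_, RatFunc.eval_mul (RingHom.id ℚ) t₀ hf hg⟩
  have := eval_eq_zero_of_dvd_of_eval_eq_zero (RatFunc.denom_mul_dvd f g) h0
  simp [hf, hg] at this

theorem hasValue_algebraMap (p : ℚ[X]) : HasValue t₀ (algebraMap ℚ[X] (RatFunc ℚ) p) (p.eval t₀) :=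
  ⟨by simp, by simp [value]⟩

theorem hasValue_one : HasValue t₀ 1 1 := by
  simpa using hasValue_algebraMap (t₀ := t₀) 1

theorem HasValue.neg (hf : HasValue t₀ f c) : HasValue t₀ (-f) (-c) := by
  have h : HasValue t₀ (-1) (-1) := by simpa using hasValue_algebraMap (t₀ := t₀) (-1)
  simpa using h.mul hf

theorem HasValue.sub (hf : HasValue t₀ f c) (hg : HasValue t₀ g d) :
    HasValue t₀ (f - g) (c - d) := by
  simpa [sub_eq_add_neg] using hf.add hg.neg

theorem HasValue.pow (hf : HasValue t₀ f c) (n : ℕ) : HasValue t₀ (f ^ n) (c ^ n) := by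
  induction n with
  | zero => simpa using hasValue_one
  | succ n ih => simpa [pow_succ] using ih.mul hf

theorem HasValue.of_eq (hf : HasValue t₀ f c) (hfg : f = g) (hcd : c = d) : HasValue t₀ g d := by
  subst hfg hcd
  exact hf

theorem hasValue_inv_of_pole (h : f.denom.eval t₀ = 0) : f ≠ 0 ∧ HasValue t₀ f⁻¹ 0 := by
  have hf : f ≠ 0 := by
    rintro rfl
    simp at h
  have hnum : f.num.eval t₀ ≠ 0 := by
    intro h0
    obtain ⟨a, b, hab⟩ := f.isCoprime_num_denom
    have := congrArg (Polynomial.eval t₀) hab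
    simp [h, h0] at this
  have hden : (f⁻¹).denom.eval t₀ ≠ 0 := by
    intro h0
    have : (f⁻¹).denom ∣ f.num := by
      rw [RatFunc.denom_dvd (RatFunc.num_ne_zero hf)]
      refine ⟨f.denom, ?_⟩
      nth_rw 1 [← f.num_div_denom]
      rw [inv_div]
    exact hnum (eval_eq_zero_of_dvd_of_eval_eq_zero this h0)
  have h1 : HasValue t₀ (f⁻¹ * algebraMap ℚ[X] (RatFunc ℚ) f.num)
      (value t₀ f⁻¹ * f.num.eval t₀) := (hasValue_value hden).mul (hasValue_algebraMap _)
  have h2 : f⁻¹ * algebraMap ℚ[X] (RatFunc ℚ) f.num = algebraMap ℚ[X] (RatFunc ℚ) f.denom := by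
    have : algebraMap ℚ[X] (RatFunc ℚ) f.denom ≠ 0 := by simpa using f.denom_ne_zero
    nth_rw 1 [← f.num_div_denom]
    have : algebraMap ℚ[X] (RatFunc ℚ) f.num ≠ 0 := by simpa using hf
    field_simp
  rw [h2] at h1
  have h3 := h1.unique (hasValue_algebraMap f.denom)
  rw [h] at h3
  refine ⟨hf, hden, ?_⟩
  simpa [hnum] using h3

theorem HasValue.inv (hf : HasValue t₀ f c) (hc : c ≠ 0) : HasValue t₀ f⁻¹ c⁻¹ := by
  have hf0 : f ≠ 0 := by
    rintro rfl
    exact hc (hf.unique ((hasValue_algebraMap 0).of_eq (map_zero _) (by simp)))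
  by_cases h : (f⁻¹).denom.eval t₀ = 0
  · have h1 := (hasValue_inv_of_pole h).2
    rw [inv_inv] at h1
    exact absurd (hf.unique h1) hc
  · refine ⟨h, ?_⟩
    have := (hf.mul (hasValue_value h)).of_eq (mul_inv_cancel₀ hf0) rfl |>.unique hasValue_one
    exact eq_inv_of_mul_eq_one_right this

/-- The local ring at `t₀` is integrally closed: a pole of `f` would be a pole of `f ^ 2`. -/
theorem HasValue.exists_of_sq (hf : HasValue t₀ (f ^ 2) c) : ∃ d, HasValue t₀ f d ∧ d ^ 2 = c := by
  by_cases h : f.denom.eval t₀ = 0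
  · obtain ⟨h0, h1⟩ := hasValue_inv_of_pole h
    have h2 := (hf.mul (h1.pow 2)).of_eq (g := 1) (by field_simp) rfl |>.unique hasValue_one
    simp at h2
  · exact ⟨_, hasValue_value h, ((hasValue_value h).pow 2).unique hf⟩

/-! ### Lines meeting a curve in short Weierstrass form -/

/-- The line `y = lx + m` meets `y² = x³ + Ax + B` in the points `(xᵢ, yᵢ)`, with multiplicity. -/
structure LineMeets {F : Type*} [Field F] (A B l m x₁ y₁ x₂ y₂ x₃ y₃ : F) : Prop where
  y₁_eq : y₁ = l * x₁ + m
  y₂_eq : y₂ = l * x₂ + m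
  y₃_eq : y₃ = l * x₃ + m
  sum_eq : x₁ + x₂ + x₃ = l ^ 2
  sum_mul_eq : x₁ * x₂ + x₁ * x₃ + x₂ * x₃ = A - 2 * l * m
  prod_eq : x₁ * x₂ * x₃ = m ^ 2 - B

section Line

variable {F : Type*} [Field F] {A B l m x₁ y₁ x₂ y₂ x₃ y₃ : F}

theorem LineMeets.rotate (h : LineMeets A B l m x₁ y₁ x₂ y₂ x₃ y₃) :
    LineMeets A B l m x₂ y₂ x₃ y₃ x₁ y₁ :=
  ⟨h.y₂_eq, h.y₃_eq, h.y₁_eq, by linear_combination h.sum_eq, by linear_combination h.sum_mul_eq,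
    by linear_combination h.prod_eq⟩

/-- This form of the slope remains meaningful for `x₁ = x₂`, where the chord formula degenerates. -/
theorem LineMeets.slope_mul (h : LineMeets A B l m x₁ y₁ x₂ y₂ x₃ y₃) :
    l * (y₁ + y₂) = x₁ ^ 2 + x₁ * x₂ + x₂ ^ 2 + A := by
  linear_combination l * h.y₁_eq + l * h.y₂_eq + h.sum_mul_eq - (x₁ + x₂) * h.sum_eq

variable {W : WeierstrassCurve.Affine F} [DecidableEq F]

open WeierstrassCurve.Affine in
theorem exists_lineMeets (h₁ : W.a₁ = 0) (h₂ : W.a₂ = 0) (h₃ : W.a₃ = 0)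
    {n₁ : W.Nonsingular x₁ y₁} {n₂ : W.Nonsingular x₂ y₂} {n₃ : W.Nonsingular x₃ y₃}
    (h : Point.some x₁ y₁ n₁ + Point.some x₂ y₂ n₂ + Point.some x₃ y₃ n₃ = 0) :
    ∃ l m, LineMeets W.a₄ W.a₆ l m x₁ y₁ x₂ y₂ x₃ y₃ := by
  have e₁ := (equation_iff x₁ y₁).1 n₁.1
  have e₂ := (equation_iff x₂ y₂).1 n₂.1
  simp only [h₁, h₂, h₃, zero_mul, add_zero] at e₁ e₂
  have h' := eq_neg_of_add_eq_zero_left h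
  have hxy : ¬(x₁ = x₂ ∧ y₁ = W.negY x₂ y₂) := by
    rintro ⟨hx, hy⟩
    rw [Point.add_of_Y_eq hx hy, Point.neg_some] at h'
    exact Point.some_ne_zero _ h'.symm
  rw [Point.add_some hxy, Point.neg_some, Point.some.injEq] at h'
  obtain ⟨hx, hy⟩ := h'
  set l := W.slope x₁ x₂ y₁ y₂ with hl
  simp only [addX, addY, negAddY, negY, h₁, h₂, h₃, zero_mul, add_zero, sub_zero] at hx hy
  have hkey : y₁ - y₂ = l * (x₁ - x₂) ∧ l * (y₁ + y₂) = x₁ ^ 2 + x₁ * x₂ + x₂ ^ 2 + W.a₄ := by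
    by_cases hxx : x₁ = x₂
    · have hyne : y₁ ≠ W.negY x₂ y₂ := fun hc => hxy ⟨hxx, hc⟩
      rw [slope_of_Y_ne hxx hyne] at hl
      have hyy := Y_eq_of_Y_ne n₁.1 n₂.1 hxx hyne
      subst hxx hyy
      simp only [negY, h₁, h₂, h₃, zero_mul, sub_zero] at hl hyne
      have : y₁ - -y₁ ≠ 0 := sub_ne_zero.2 hyne
      refine ⟨by ring, ?_⟩
      rw [hl]
      have h2 : y₁ + y₁ ≠ 0 := by simpa using this
      rw [sub_neg_eq_add, div_mul_cancel₀ _ h2]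
      ring
    · rw [slope_of_X_ne hxx] at hl
      have h0 : x₁ - x₂ ≠ 0 := sub_ne_zero.2 hxx
      have h1 : y₁ - y₂ = l * (x₁ - x₂) := by rw [hl]; field_simp
      refine ⟨h1, mul_left_cancel₀ h0 ?_⟩
      linear_combination e₁ - e₂ - (y₁ + y₂) * h1
  obtain ⟨hk₁, hk₂⟩ := hkey
  have hx' : x₃ = l ^ 2 - x₁ - x₂ := by linear_combination -hx
  have hy' : y₃ = l * (x₃ - x₁) + y₁ := by rw [← hx]; linear_combination hy
  refine ⟨l, y₁ - l * x₁, by ring, by linear_combination -hk₁, by linear_combination hy',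
    by linear_combination hx', ?_, ?_⟩
  · linear_combination (x₁ + x₂) * hx' + hk₂ + l * hk₁
  · linear_combination x₁ * x₂ * hx' - e₁ + x₁ * hk₂ + l * x₁ * hk₁

open WeierstrassCurve.Affine in
theorem LineMeets.add_eq_zero [CharZero F] (h₁ : W.a₁ = 0) (h₂ : W.a₂ = 0) (h₃ : W.a₃ = 0)
    (h : LineMeets W.a₄ W.a₆ l m x₁ y₁ x₂ y₂ x₃ y₃)
    (n₁ : W.Nonsingular x₁ y₁) (n₂ : W.Nonsingular x₂ y₂) (n₃ : W.Nonsingular x₃ y₃) :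
    Point.some x₁ y₁ n₁ + Point.some x₂ y₂ n₂ + Point.some x₃ y₃ n₃ = 0 := by
  have hs := h.slope_mul
  -- Opposite points on the non-vertical line have `y₁ = y₂ = 0`. The slope relation then makes both
  -- partial derivatives vanish, against nonsingularity.
  have hxy : ¬(x₁ = x₂ ∧ y₁ = W.negY x₂ y₂) := by
    rintro ⟨hx, hy⟩
    simp only [negY, h₁, h₃, zero_mul, sub_zero] at hy
    subst hx
    have hyy : y₁ = y₂ := by rw [h.y₁_eq, h.y₂_eq]
    have hy0 : y₁ = 0 := by
      have : 2 * y₁ = 0 := by linear_combination hy + hyy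
      simpa using this
    have hy0' : y₂ = 0 := hyy ▸ hy0
    have := ((nonsingular_iff x₁ y₁).1 n₁).2
    simp only [h₁, h₂, h₃, hy0, zero_mul, sub_zero, neg_zero, mul_zero, add_zero] at this
    rw [hy0, hy0'] at hs
    refine this.elim (fun h0 => h0 ?_) (fun h0 => h0 rfl)
    linear_combination hs
  have hl : W.slope x₁ x₂ y₁ y₂ = l := by
    by_cases hxx : x₁ = x₂
    · have hyne : y₁ ≠ W.negY x₂ y₂ := fun hc => hxy ⟨hxx, hc⟩
      rw [slope_of_Y_ne hxx hyne]
      have hyy := Y_eq_of_Y_ne n₁.1 n₂.1 hxx hyne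
      subst hxx hyy
      simp only [negY, h₁, h₂, h₃, zero_mul, sub_zero] at hyne ⊢
      rw [div_eq_iff (sub_ne_zero.2 hyne)]
      linear_combination -hs
    · rw [slope_of_X_ne hxx, div_eq_iff (sub_ne_zero.2 hxx), h.y₁_eq, h.y₂_eq]
      ring
  rw [add_eq_zero_iff_eq_neg, Point.add_some hxy, Point.neg_some, Point.some.injEq, hl]
  simp only [addX, addY, negAddY, negY, h₁, h₂, h₃, zero_mul, add_zero, sub_zero]
  have hx : l ^ 2 - x₁ - x₂ = x₃ := by linear_combination -h.sum_eq
  refine ⟨hx, ?_⟩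
  rw [hx, h.y₃_eq, h.y₁_eq]
  ring

end Line

/-! ### Specialization is a homomorphism -/

section Reduction

variable {A B : ℚ[X]} {t₀ : ℚ} {l m x₁ y₁ x₂ y₂ x₃ y₃ : RatFunc ℚ}

theorem generic_equation_iff {x y : RatFunc ℚ} : (generic A B).Equation x y ↔
    y ^ 2 = x ^ 3 + algebraMap ℚ[X] (RatFunc ℚ) A * x + algebraMap ℚ[X] (RatFunc ℚ) B := by
  rw [WeierstrassCurve.Affine.equation_iff]
  simp [generic]

/-- The line through points without poles reduces to the line through the reduced points. -/
theorem LineMeets.reduce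
    (h : LineMeets (algebraMap ℚ[X] (RatFunc ℚ) A) (algebraMap ℚ[X] (RatFunc ℚ) B)
      l m x₁ y₁ x₂ y₂ x₃ y₃) {a₁ b₁ a₂ b₂ a₃ b₃ : ℚ}
    (hx₁ : HasValue t₀ x₁ a₁) (hy₁ : HasValue t₀ y₁ b₁) (hx₂ : HasValue t₀ x₂ a₂)
    (hy₂ : HasValue t₀ y₂ b₂) (hx₃ : HasValue t₀ x₃ a₃) (hy₃ : HasValue t₀ y₃ b₃) :
    ∃ k n, LineMeets (A.eval t₀) (B.eval t₀) k n a₁ b₁ a₂ b₂ a₃ b₃ := by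
  -- The slope has no pole, because its square is the sum of the three `x`-coordinates.
  obtain ⟨k, hk, hk2⟩ := (((hx₁.add hx₂).add hx₃).of_eq h.sum_eq rfl).exists_of_sq
  have hm : HasValue t₀ m (b₁ - k * a₁) :=
    (hy₁.sub (hk.mul hx₁)).of_eq (by linear_combination h.y₁_eq) rfl
  have hA := hasValue_algebraMap (t₀ := t₀) A
  have hB := hasValue_algebraMap (t₀ := t₀) B
  have h2 : HasValue t₀ (2 : RatFunc ℚ) 2 :=
    (hasValue_algebraMap (2 : ℚ[X])).of_eq (map_ofNat _ 2) (by simp)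
  refine ⟨k, b₁ - k * a₁, ?_, ?_, ?_, ?_, ?_, ?_⟩
  · ring
  · exact (hy₂.of_eq h.y₂_eq rfl).unique ((hk.mul hx₂).add hm)
  · exact (hy₃.of_eq h.y₃_eq rfl).unique ((hk.mul hx₃).add hm)
  · exact hk2.symm
  · exact ((((hx₁.mul hx₂).add (hx₁.mul hx₃)).add (hx₂.mul hx₃)).of_eq h.sum_mul_eq rfl).unique
      (hA.sub ((h2.mul hk).mul hm))
  · exact (((hx₁.mul hx₂).mul hx₃).of_eq h.prod_eq rfl).unique ((hm.pow 2).sub hB)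

/-- If exactly one point reduces to infinity, the other two reduce to opposite points. -/
theorem LineMeets.opposite_of_pole
    (h : LineMeets (algebraMap ℚ[X] (RatFunc ℚ) A) (algebraMap ℚ[X] (RatFunc ℚ) B)
      l m x₁ y₁ x₂ y₂ x₃ y₃) {a₁ b₁ a₂ b₂ : ℚ}
    (hx₁ : HasValue t₀ x₁ a₁) (hy₁ : HasValue t₀ y₁ b₁) (hx₂ : HasValue t₀ x₂ a₂)
    (hy₂ : HasValue t₀ y₂ b₂) (hx₃ : x₃.denom.eval t₀ = 0) : a₁ = a₂ ∧ b₁ = -b₂ := by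
  -- If `l` has a pole, dividing `y₁ - y₂` and the slope relation by `l` shows that `x₁ - x₂` and
  -- `y₁ + y₂` vanish at `t₀`. Otherwise `x₃ = l ^ 2 - x₁ - x₂` would have no pole.
  by_cases hl : l.denom.eval t₀ = 0
  · obtain ⟨hl0, hinv⟩ := hasValue_inv_of_pole hl
    have h1 : HasValue t₀ (x₁ - x₂) ((b₁ - b₂) * 0) := ((hy₁.sub hy₂).mul hinv).of_eq (by
      rw [h.y₁_eq, h.y₂_eq]
      field_simp
      ring) rfl
    have h2 := ((((hx₁.pow 2).add (hx₁.mul hx₂)).add (hx₂.pow 2)).add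
      (hasValue_algebraMap (t₀ := t₀) A)).mul hinv
    rw [← h.slope_mul] at h2
    have h3 := (h2.of_eq (g := y₁ + y₂) (by field_simp) rfl).unique (hy₁.add hy₂)
    have h4 := h1.unique (hx₁.sub hx₂)
    constructor
    · linear_combination -h4
    · linear_combination -h3
  · have hl' := hasValue_value hl
    have h1 := (((hl'.pow 2).sub hx₁).sub hx₂).of_eq (g := x₃)
      (by linear_combination -h.sum_eq) rfl
    exact absurd hx₃ h1.1

/-- The points reducing to infinity are closed under addition. -/
theorem LineMeets.no_two_poles
    (h : LineMeets (algebraMap ℚ[X] (RatFunc ℚ) A) (algebraMap ℚ[X] (RatFunc ℚ) B)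
      l m x₁ y₁ x₂ y₂ x₃ y₃) (h₂ : (generic A B).Equation x₂ y₂) {a₁ b₁ : ℚ}
    (hx₁ : HasValue t₀ x₁ a₁) (hy₁ : HasValue t₀ y₁ b₁)
    (hx₂ : x₂.denom.eval t₀ = 0) (hx₃ : x₃.denom.eval t₀ = 0) : False := by
  obtain ⟨hx₂0, hz₂⟩ := hasValue_inv_of_pole hx₂
  obtain ⟨hx₃0, hz₃⟩ := hasValue_inv_of_pole hx₃
  rw [generic_equation_iff] at h₂
  have hA := hasValue_algebraMap (t₀ := t₀) A
  have hB := hasValue_algebraMap (t₀ := t₀) B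
  have h2 : HasValue t₀ (2 : RatFunc ℚ) 2 :=
    (hasValue_algebraMap (2 : ℚ[X])).of_eq (map_ofNat _ 2) (by simp)
  have hcube : HasValue t₀ (y₂ ^ 2 * x₂⁻¹ ^ 3) 1 :=
    ((hasValue_one.add (hA.mul (hz₂.pow 2))).add (hB.mul (hz₂.pow 3))).of_eq
      (by rw [h₂]; field_simp) (by norm_num)
  obtain ⟨e, he, he2⟩ := HasValue.exists_of_sq (f := y₂ * x₂⁻¹ ^ 2)
    ((hcube.mul hz₂).of_eq (by ring) rfl)
  have hdiff : HasValue t₀ ((y₁ - y₂) ^ 2 * x₂⁻¹ ^ 3) 1 :=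
    ((((hy₁.pow 2).mul (hz₂.pow 3)).sub (((h2.mul hy₁).mul he).mul hz₂)).add hcube).of_eq
      (by ring) (by ring)
  have hu : HasValue t₀ ((x₁ * x₂⁻¹ - 1) ^ 2) 1 :=
    (((hx₁.mul hz₂).sub hasValue_one).pow 2).of_eq rfl (by norm_num)
  have hu0 : x₁ * x₂⁻¹ - 1 ≠ 0 := by
    intro h0
    rw [h0] at hu
    exact one_ne_zero (hu.unique ((hasValue_algebraMap 0).of_eq (by simp) (by simp)))
  -- Near infinity `y₂ ^ 2 ~ x₂ ^ 3`, so the slope satisfies `l ^ 2 ~ x₂`.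
  have hl2 : HasValue t₀ (l ^ 2 * x₂⁻¹) 1 := by
    refine (hdiff.mul (hu.inv one_ne_zero)).of_eq ?_ (by norm_num)
    have : y₁ - y₂ = l * x₂ * (x₁ * x₂⁻¹ - 1) := by
      rw [h.y₁_eq, h.y₂_eq]
      field_simp
      ring
    rw [this]
    generalize x₁ * x₂⁻¹ - 1 = k at hu0
    field_simp
  obtain ⟨e', he', he2'⟩ := HasValue.exists_of_sq (f := l * x₂⁻¹)
    ((hl2.mul hz₂).of_eq (by ring) rfl)
  have hL : HasValue t₀ (1 + x₁ * (x₂⁻¹ + x₃⁻¹)) (1 + a₁ * (0 + 0)) :=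
    hasValue_one.add (hx₁.mul (hz₂.add hz₃))
  have hR := (((hA.mul hz₂).mul hz₃).sub (((h2.mul he').mul hy₁).mul hz₃)).add
    (((h2.mul hl2).mul hx₁).mul hz₃)
  -- This is the second symmetric function relation divided by `x₂ * x₃`. The left side has value
  -- `1` at `t₀` and the right side `0`.
  have heq : 1 + x₁ * (x₂⁻¹ + x₃⁻¹) =
      algebraMap ℚ[X] (RatFunc ℚ) A * x₂⁻¹ * x₃⁻¹ - 2 * (l * x₂⁻¹) * y₁ * x₃⁻¹ +
        2 * (l ^ 2 * x₂⁻¹) * x₁ * x₃⁻¹ := by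
    field_simp
    linear_combination h.sum_mul_eq + 2 * l * h.y₁_eq
  have := (hL.of_eq heq rfl).unique hR
  norm_num at this

variable {hE : (fiber A B t₀).IsElliptic}

theorem specialization_some_of_pole {x y : RatFunc ℚ} (n : (generic A B).Nonsingular x y)
    (h : x.denom.eval t₀ = 0) : specialization A B t₀ hE (.some x y n) = 0 := by
  simp only [specialization, dif_pos h]
  rfl

theorem exists_specialization_some {x y : RatFunc ℚ} (n : (generic A B).Nonsingular x y)
    (h : x.denom.eval t₀ ≠ 0) : ∃ a b, ∃ n' : (fiber A B t₀).Nonsingular a b,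
      HasValue t₀ x a ∧ HasValue t₀ y b ∧
        specialization A B t₀ hE (.some x y n) = .some a b n' := by
  refine ⟨value t₀ x, value t₀ y, (fiber A B t₀).equation_iff_nonsingular.1
    (equation_value n.1 h), hasValue_value h, hasValue_value (denom_y_ne_zero n.1 h), ?_⟩
  simp only [specialization, dif_neg h]

theorem specialization_zero : specialization A B t₀ hE 0 = 0 := rfl

open WeierstrassCurve.Affine

theorem specialization_neg (P : (generic A B).Point) :
    specialization A B t₀ hE (-P) = -specialization A B t₀ hE P := by
  rcases P with _ | ⟨x, y, n⟩
  · rfl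
  · rw [Point.neg_some]
    by_cases h : x.denom.eval t₀ = 0
    · rw [specialization_some_of_pole _ h, specialization_some_of_pole _ h, Point.neg_zero]
    · obtain ⟨a, b, n', ha, hb, hP⟩ := exists_specialization_some (hE := hE) n h
      obtain ⟨a', b', n'', ha', hb', hP'⟩ := exists_specialization_some (hE := hE)
        ((nonsingular_neg ..).2 n) h
      rw [hP, hP', Point.neg_some, Point.some.injEq]
      refine ⟨ha'.unique ha, ?_⟩
      have : (generic A B).negY x y = -y := by simp [negY, generic]
      rw [this] at hb'
      rw [hb'.unique hb.neg]
      simp [negY, fiber]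

variable [DecidableEq (RatFunc ℚ)]

theorem specialization_add_add_eq_zero (P Q R : (generic A B).Point) (h : P + Q + R = 0) :
    specialization A B t₀ hE P + specialization A B t₀ hE Q + specialization A B t₀ hE R = 0 := by
  rcases P with _ | ⟨x₁, y₁, n₁⟩
  · have : R = -Q := by
      rw [← Point.zero_def, zero_add] at h
      exact eq_neg_of_add_eq_zero_right h
    rw [this, specialization_neg, ← Point.zero_def, specialization_zero]
    abel
  rcases Q with _ | ⟨x₂, y₂, n₂⟩
  · have : R = -.some x₁ y₁ n₁ := by
      rw [← Point.zero_def, add_zero] at h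
      exact eq_neg_of_add_eq_zero_right h
    rw [this, specialization_neg, ← Point.zero_def, specialization_zero]
    abel
  rcases R with _ | ⟨x₃, y₃, n₃⟩
  · have : Point.some x₂ y₂ n₂ = -.some x₁ y₁ n₁ := by
      rw [← Point.zero_def, add_zero] at h
      exact eq_neg_of_add_eq_zero_right h
    rw [this, specialization_neg, ← Point.zero_def, specialization_zero]
    abel
  obtain ⟨l, m, hL⟩ := exists_lineMeets rfl rfl rfl h
  change LineMeets (algebraMap ℚ[X] (RatFunc ℚ) A) (algebraMap ℚ[X] (RatFunc ℚ) B) _ _ _ _ _ _ _ _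
    at hL
  have opp {a b a' b' : ℚ} {n : (fiber A B t₀).Nonsingular a b}
      {n' : (fiber A B t₀).Nonsingular a' b'} (h : a = a' ∧ b = -b') :
      Point.some a b n + Point.some a' b' n' = 0 :=
    Point.add_of_Y_eq h.1 (by simp [negY, fiber, h.2])
  -- Three poles are trivial, exactly two are impossible, one leaves two opposite points, and none
  -- leaves a line to reduce.
  by_cases p₁ : x₁.denom.eval t₀ = 0 <;> by_cases p₂ : x₂.denom.eval t₀ = 0 <;>
    by_cases p₃ : x₃.denom.eval t₀ = 0
  · simp only [specialization_some_of_pole _ p₁, specialization_some_of_pole _ p₂,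
      specialization_some_of_pole _ p₃, add_zero]
  · obtain ⟨a, b, n, ha, hb, hP⟩ := exists_specialization_some (hE := hE) n₃ p₃
    exact (hL.rotate.rotate.no_two_poles n₁.1 ha hb p₁ p₂).elim
  · obtain ⟨a, b, n, ha, hb, hP⟩ := exists_specialization_some (hE := hE) n₂ p₂
    exact (hL.rotate.no_two_poles n₃.1 ha hb p₃ p₁).elim
  · obtain ⟨a, b, n, ha, hb, hP⟩ := exists_specialization_some (hE := hE) n₂ p₂
    obtain ⟨a', b', n', ha', hb', hP'⟩ := exists_specialization_some (hE := hE) n₃ p₃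
    rw [specialization_some_of_pole _ p₁, hP, hP', zero_add]
    exact opp (hL.rotate.opposite_of_pole ha hb ha' hb' p₁)
  · obtain ⟨a, b, n, ha, hb, hP⟩ := exists_specialization_some (hE := hE) n₁ p₁
    exact (hL.no_two_poles n₂.1 ha hb p₂ p₃).elim
  · obtain ⟨a, b, n, ha, hb, hP⟩ := exists_specialization_some (hE := hE) n₃ p₃
    obtain ⟨a', b', n', ha', hb', hP'⟩ := exists_specialization_some (hE := hE) n₁ p₁
    rw [specialization_some_of_pole _ p₂, hP, hP', add_zero, add_comm]
    exact opp (hL.rotate.rotate.opposite_of_pole ha hb ha' hb' p₂)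
  · obtain ⟨a, b, n, ha, hb, hP⟩ := exists_specialization_some (hE := hE) n₁ p₁
    obtain ⟨a', b', n', ha', hb', hP'⟩ := exists_specialization_some (hE := hE) n₂ p₂
    rw [specialization_some_of_pole _ p₃, hP, hP', add_zero]
    exact opp (hL.opposite_of_pole ha hb ha' hb' p₃)
  · obtain ⟨a, b, n, ha, hb, hP⟩ := exists_specialization_some (hE := hE) n₁ p₁
    obtain ⟨a', b', n', ha', hb', hP'⟩ := exists_specialization_some (hE := hE) n₂ p₂
    obtain ⟨a'', b'', n'', ha'', hb'', hP''⟩ := exists_specialization_some (hE := hE) n₃ p₃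
    obtain ⟨k, c, hk⟩ := hL.reduce ha hb ha' hb' ha'' hb''
    rw [hP, hP', hP'']
    exact LineMeets.add_eq_zero rfl rfl rfl hk n n' n''

/-- The specialization map as a homomorphism. -/
noncomputable def specializationHom (A B : ℚ[X]) (t₀ : ℚ) (hE : (fiber A B t₀).IsElliptic) :
    (generic A B).Point →+ (fiber A B t₀).Point where
  toFun := specialization A B t₀ hE
  map_zero' := rfl
  map_add' P Q := by
    have := specialization_add_add_eq_zero (hE := hE) P Q (-(P + Q)) (add_neg_cancel _)
    rw [specialization_neg] at this
    rw [eq_comm, ← sub_eq_zero, sub_eq_add_neg]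
    exact this

end Reduction

/-! ### Independence modulo doubling -/

/-- In a group without two-torsion, `p` and `q` are independent as soon as none of `p`, `q`, `p + q`
is divisible by two. -/
theorem eq_zero_of_not_divisible {G : Type*} [AddCommGroup G] {p q : G}
    (h₂ : ∀ r : G, r + r = 0 → r = 0) (hp : ∀ r : G, r + r ≠ p) (hq : ∀ r : G, r + r ≠ q)
    (hpq : ∀ r : G, r + r ≠ p + q) (N : ℕ) :
    ∀ a b : ℤ, a.natAbs + b.natAbs = N → a • p + b • q = 0 → a = 0 ∧ b = 0 := by
  induction N using Nat.strong_induction_on with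
  | _ N ih =>
  intro a b hN h
  -- If both coefficients are even, absence of 2-torsion lets the relation be halved. In the other
  -- cases `p`, `q` or `p + q` is twice `-(c • p + d • q)`.
  obtain ⟨c, hc | hc⟩ := Int.even_or_odd' a <;> obtain ⟨d, hd | hd⟩ := Int.even_or_odd' b <;>
    subst hc hd
  · by_cases h0 : c = 0 ∧ d = 0
    · simp [h0]
    · refine absurd (ih (c.natAbs + d.natAbs) (by omega) c d rfl (h₂ _ ?_)) h0
      rw [← h]
      module
  · refine absurd ?_ (hq (-(c • p + d • q)))
    rw [← sub_eq_zero, ← neg_eq_zero, ← h]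
    module
  · refine absurd ?_ (hp (-(c • p + d • q)))
    rw [← sub_eq_zero, ← neg_eq_zero, ← h]
    module
  · refine absurd ?_ (hpq (-(c • p + d • q)))
    rw [← sub_eq_zero, ← neg_eq_zero, ← h]
    module

/-! ### Torsion and halving on the fibre -/

section Fiber

open WeierstrassCurve.Affine

variable {t₀ : ℚ}

theorem eval_coeffA : coeffA.eval t₀ = -(t₀ ^ 2 + 27) := by simp [coeffA]

theorem eval_coeffB : coeffB.eval t₀ = 10 * t₀ ^ 2 + 48 * t₀ + 90 := by simp [coeffB]

theorem fiber_equation_iff {A B : ℚ[X]} {x y : ℚ} : (fiber A B t₀).Equation x y ↔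
    y ^ 2 = x ^ 3 + A.eval t₀ * x + B.eval t₀ := by
  rw [equation_iff]
  simp [fiber]

theorem isElliptic_fiber
    (hg : ∀ x : ℚ, x ^ 3 - (t₀ ^ 2 + 27) * x + (10 * t₀ ^ 2 + 48 * t₀ + 90) ≠ 0) :
    (fiber coeffA coeffB t₀).IsElliptic := by
  refine ⟨isUnit_iff_ne_zero.2 fun h => ?_⟩
  simp only [WeierstrassCurve.Δ, WeierstrassCurve.b₂, WeierstrassCurve.b₄, WeierstrassCurve.b₆,
    WeierstrassCurve.b₈, fiber, eval_coeffA, eval_coeffB] at h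
  have hA : t₀ ^ 2 + 27 ≠ 0 := by positivity
  -- When the discriminant of `x ^ 3 - a * x + b` vanishes, `3 * b / (2 * a)` is the repeated root.
  apply hg (3 * (10 * t₀ ^ 2 + 48 * t₀ + 90) / (2 * (t₀ ^ 2 + 27)))
  generalize t₀ ^ 2 + 27 = a at *
  generalize 10 * t₀ ^ 2 + 48 * t₀ + 90 = b at *
  have h' : 27 * b ^ 2 = 4 * a ^ 3 := by linear_combination (-1 / 16) * h
  field_simp
  linear_combination b * h'

theorem eq_zero_of_add_self
    (hg : ∀ x : ℚ, x ^ 3 - (t₀ ^ 2 + 27) * x + (10 * t₀ ^ 2 + 48 * t₀ + 90) ≠ 0)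
    (R : (fiber coeffA coeffB t₀).Point) (h : R + R = 0) : R = 0 := by
  rcases R with _ | ⟨x, y, n⟩
  · rfl
  · exfalso
    have h1 := eq_neg_of_add_eq_zero_left h
    rw [Point.neg_some, Point.some.injEq] at h1
    have hy : y = -y := by simpa [negY, fiber] using h1.2
    have hy0 : y = 0 := by linarith
    have h2 := fiber_equation_iff.1 n.1
    rw [hy0, eval_coeffA, eval_coeffB] at h2
    exact hg x (by linear_combination -h2)

/-- The slope of the tangent line at a point `R` with `-2R = (x, y)` satisfies a quartic equation. -/
theorem exists_tangent_slope {A B : ℚ[X]} {x y : ℚ} {n : (fiber A B t₀).Nonsingular x y}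
    {R : (fiber A B t₀).Point} (h : R + R + .some x y n = 0) :
    ∃ l : ℚ, l ^ 4 - 6 * x * l ^ 2 + 8 * y * l - 3 * x ^ 2 - 4 * A.eval t₀ = 0 := by
  rcases R with _ | ⟨a, b, n'⟩
  · rw [← Point.zero_def, zero_add, zero_add] at h
    exact absurd h (Point.some_ne_zero n)
  · obtain ⟨l, m, hL⟩ := exists_lineMeets rfl rfl rfl h
    have h1 := hL.sum_mul_eq
    change _ = A.eval t₀ - _ at h1
    have h2 := hL.sum_eq
    have h3 := hL.y₃_eq
    refine ⟨l, ?_⟩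
    -- The tangency point counts twice, so the sum of roots and the third point express `a` and `m`
    -- through `l`. The remaining symmetric function gives the quartic.
    have ha : a = (l ^ 2 - x) / 2 := by linear_combination h2 / 2
    have hm : m = y - l * x := by linear_combination -h3
    rw [ha, hm] at h1
    linear_combination 4 * h1

theorem hasValue_X : HasValue t₀ RatFunc.X t₀ :=
  (hasValue_algebraMap Polynomial.X).of_eq RatFunc.algebraMap_X (by simp)

theorem hasValue_ofNat (k : ℕ) [k.AtLeastTwo] :
    HasValue t₀ (OfNat.ofNat k : RatFunc ℚ) (OfNat.ofNat k : ℚ) :=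
  (hasValue_algebraMap (OfNat.ofNat k : ℚ[X])).of_eq (map_ofNat _ k) (by simp)

theorem exists_specialization_of_hasValue {A B : ℚ[X]} {hE : (fiber A B t₀).IsElliptic}
    {x y : RatFunc ℚ} {a b : ℚ} (n : (generic A B).Nonsingular x y) (hx : HasValue t₀ x a)
    (hy : HasValue t₀ y b) :
    ∃ n', specialization A B t₀ hE (.some x y n) = .some a b n' := by
  obtain ⟨a', b', n', ha, hb, h⟩ := exists_specialization_some (hE := hE) n hx.1
  obtain rfl := ha.unique hx
  obtain rfl := hb.unique hy
  exact ⟨n', h⟩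

variable {hE : (fiber coeffA coeffB t₀).IsElliptic}

theorem exists_specialization_P : ∃ n, specialization coeffA coeffB t₀ hE pointP =
    .some (t₀ + 3) (4 * t₀ + 6) n :=
  exists_specialization_of_hasValue _ (hasValue_X.add (hasValue_ofNat 3))
    (((hasValue_ofNat 4).mul hasValue_X).add (hasValue_ofNat 6))

theorem exists_specialization_Q : ∃ n, specialization coeffA coeffB t₀ hE pointQ =
    .some 9 (t₀ + 24) n :=
  exists_specialization_of_hasValue _ (hasValue_ofNat 9) (hasValue_X.add (hasValue_ofNat 24))

/-- The sum of the two specialized points is the opposite of `(-t₀ - 3, -2t₀ - 12)`. -/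
theorem exists_specialization_P_add_Q : ∃ n, specialization coeffA coeffB t₀ hE pointP +
    specialization coeffA coeffB t₀ hE pointQ + .some (-t₀ - 3) (-2 * t₀ - 12) n = 0 := by
  obtain ⟨nP, hP⟩ := exists_specialization_P (hE := hE)
  obtain ⟨nQ, hQ⟩ := exists_specialization_Q (hE := hE)
  have n : (fiber coeffA coeffB t₀).Nonsingular (-t₀ - 3) (-2 * t₀ - 12) := by
    refine (fiber coeffA coeffB t₀).equation_iff_nonsingular.1 (fiber_equation_iff.2 ?_)
    rw [eval_coeffA, eval_coeffB]
    ring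
  refine ⟨n, ?_⟩
  rw [hP, hQ]
  -- The three points lie on `y = 3x + t₀ - 3`. Counting with multiplicity also covers coinciding
  -- points.
  refine LineMeets.add_eq_zero (l := 3) (m := t₀ - 3) rfl rfl rfl ?_ nP nQ n
  change LineMeets (coeffA.eval t₀) (coeffB.eval t₀) _ _ _ _ _ _ _ _
  rw [eval_coeffA, eval_coeffB]
  constructor <;> ring

theorem specialization_P_not_divisible
    (ht₀ : t₀ ∉ ({-26, -19, -12, -11, -5, -3, -1, 6, 9, 44} : Set ℚ))
    (R : (fiber coeffA coeffB t₀).Point) :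
    R + R ≠ specialization coeffA coeffB t₀ hE pointP := by
  intro h
  obtain ⟨n, hP⟩ := exists_specialization_P (hE := hE)
  rw [hP, ← sub_eq_zero, sub_eq_add_neg, Point.neg_some] at h
  obtain ⟨l, hl⟩ := exists_tangent_slope h
  simp only [negY, fiber, zero_mul, sub_zero, eval_coeffA] at hl
  -- The tangent quartic, monic of degree two in `t₀`, with the square completed. The roots `0, -2,
  -- -3, -7` in `l` give `t₀ = 9, -11, -12, 44`.
  have hw : (t₀ - (3 * l ^ 2 + 16 * l + 9)) ^ 2 = 8 * l * (l + 2) * (l + 3) * (l + 7) := by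
    linear_combination hl
  have h0 := TwoDescent.quartic_eq_zero_P hw
  have ht : t₀ = 3 * l ^ 2 + 16 * l + 9 := by linear_combination h0
  rw [h0] at hw
  have hroots : l = 0 ∨ l = -2 ∨ l = -3 ∨ l = -7 := by
    have : l * ((l + 2) * ((l + 3) * (l + 7))) = 0 := by linear_combination -hw / 8
    simpa [add_eq_zero_iff_eq_neg] using this
  apply ht₀
  rcases hroots with rfl | rfl | rfl | rfl <;> rw [ht] <;> norm_num

theorem specialization_Q_not_divisible
    (ht₀ : t₀ ∉ ({-26, -19, -12, -11, -5, -3, -1, 6, 9, 44} : Set ℚ))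
    (R : (fiber coeffA coeffB t₀).Point) :
    R + R ≠ specialization coeffA coeffB t₀ hE pointQ := by
  intro h
  obtain ⟨n, hQ⟩ := exists_specialization_Q (hE := hE)
  rw [hQ, ← sub_eq_zero, sub_eq_add_neg, Point.neg_some] at h
  obtain ⟨l, hl⟩ := exists_tangent_slope h
  simp only [negY, fiber, zero_mul, sub_zero, eval_coeffA] at hl
  -- Completing the square in `t₀` again; now `w = 0` means `t₀ = l`.
  have hw : (2 * (t₀ - l)) ^ 2 = -(l + 1) * (l + 3) * (l + 5) * (l - 9) := by
    linear_combination hl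
  have h0 := TwoDescent.quartic_eq_zero_Q hw
  have ht : t₀ = l := by linear_combination h0 / 2
  rw [h0] at hw
  have hroots : l = -1 ∨ l = -3 ∨ l = -5 ∨ l = 9 := by
    have : (l + 1) * ((l + 3) * ((l + 5) * (l - 9))) = 0 := by linear_combination hw
    simpa [add_eq_zero_iff_eq_neg, sub_eq_zero] using this
  apply ht₀
  rcases hroots with rfl | rfl | rfl | rfl <;> rw [ht] <;> norm_num

theorem specialization_P_add_Q_not_divisible
    (ht₀ : t₀ ∉ ({-26, -19, -12, -11, -5, -3, -1, 6, 9, 44} : Set ℚ))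
    (R : (fiber coeffA coeffB t₀).Point) :
    R + R ≠ specialization coeffA coeffB t₀ hE pointP +
      specialization coeffA coeffB t₀ hE pointQ := by
  intro h
  obtain ⟨n, hPQ⟩ := exists_specialization_P_add_Q (hE := hE)
  rw [← h] at hPQ
  obtain ⟨l, hl⟩ := exists_tangent_slope hPQ
  rw [eval_coeffA] at hl
  -- The roots `0, -2, 3, 5` in `l` give `t₀ = 9, -19, 6, -26`.
  have hw : (t₀ + (3 * l ^ 2 - 8 * l - 9)) ^ 2 = 8 * l * (l + 2) * (l - 3) * (l - 5) := by
    linear_combination hl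
  have h0 := TwoDescent.quartic_eq_zero_PQ hw
  have ht : t₀ = -(3 * l ^ 2 - 8 * l - 9) := by linear_combination h0
  rw [h0] at hw
  have hroots : l = 0 ∨ l = -2 ∨ l = 3 ∨ l = 5 := by
    have : l * ((l + 2) * ((l - 3) * (l - 5))) = 0 := by linear_combination -hw / 8
    simpa [add_eq_zero_iff_eq_neg, sub_eq_zero] using this
  apply ht₀
  rcases hroots with rfl | rfl | rfl | rfl <;> rw [ht] <;> norm_num

end Fiber

end EllipticSpecialization

/-! ### Injectivity on the subgroup -/

theorem mainTheorem6 (t₀ : ℚ)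
    (ht₀ : t₀ ∉ ({-26, -19, -12, -11, -5, -3, -1, 6, 9, 44} : Set ℚ))
    (hg : ∀ x : ℚ, x ^ 3 - (t₀ ^ 2 + 27) * x + (10 * t₀ ^ 2 + 48 * t₀ + 90) ≠ 0) :
    ∃ hE : (EllipticSpecialization.fiber EllipticSpecialization.coeffA
        EllipticSpecialization.coeffB t₀).IsElliptic,
      Set.InjOn
        (EllipticSpecialization.specialization EllipticSpecialization.coeffA
          EllipticSpecialization.coeffB t₀ hE)
        (EllipticSpecialization.subgroupM :
          Set (EllipticSpecialization.generic EllipticSpecialization.coeffA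
            EllipticSpecialization.coeffB).Point) := by
  classical
  have hE := EllipticSpecialization.isElliptic_fiber hg
  refine ⟨hE, fun S hS T hT hST => ?_⟩
  let φ := EllipticSpecialization.specializationHom EllipticSpecialization.coeffA
    EllipticSpecialization.coeffB t₀ hE
  have hsub : S - T ∈ EllipticSpecialization.subgroupM :=
    EllipticSpecialization.subgroupM.sub_mem hS hT
  obtain ⟨a, b, hab⟩ := AddSubgroup.mem_closure_pair.1 hsub
  have h0 : φ (S - T) = 0 := by
    rw [map_sub, sub_eq_zero]
    exact hST
  rw [← hab, map_add, map_zsmul, map_zsmul] at h0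
  obtain ⟨rfl, rfl⟩ := EllipticSpecialization.eq_zero_of_not_divisible
    (EllipticSpecialization.eq_zero_of_add_self hg)
    (EllipticSpecialization.specialization_P_not_divisible (hE := hE) ht₀)
    (EllipticSpecialization.specialization_Q_not_divisible (hE := hE) ht₀)
    (EllipticSpecialization.specialization_P_add_Q_not_divisible (hE := hE) ht₀) _ a b rfl h0
  rw [zero_zsmul, zero_zsmul, add_zero] at hab
  exact sub_eq_zero.1 hab.symm
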